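/- Let $\mathbb S^1=\mathbb R/\mathbb Z$, and let $M=(M_k)_{k\ge 0}$ be a non-decreasing, logarithmically convex sequence of positive real numbers ($M_k^2\le M_{k-1}M_{k+1}$ for $k\ge 1$) with $M_0=1$. Put $w(x)=\inf_{k\ge 0}x^k\,k!\,M_k$ for $x>0$. The Denjoy--Carleman class $\mathcal C^M$ is the set of $\mathcal C^\infty$ functions $f:\mathbb S^1\to\mathbb C$ for which there are constants $C,R>0$ such that $|f^{(k)}(x)|\le C R^k\,k!\,M_k$ for all $k\ge 0$ and $x\in\mathbb S^1$. Let $T:\mathbb S^1\to\mathbb S^1$ be a $\mathcal C^\infty$ map and $\lambda>1$ be such that $|T'(x)|\ge\lambda$ for all $x\in\mathbb S^1$, and assume that $T'$ belongs to $\mathcal C^M$. Let $\mathcal L$ be the transfer operator $$\mathcal L\varphi(x)=\sum_{y:\,Ty=x}\frac{1}{|T'(y)|}\,\varphi(y).$$ Then for every $\theta\in(1,\lambda)$ there are constants $C,A>0$ and a complex Hilbert space $\mathcal H$, continuously contained in $\mathcal C^\infty(\mathbb S^1)$ and containing the trigonometric polynomials as a dense subspace, such that $\mathcal L$ defines a compact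 operator from $\mathcal H$ to itself. Moreover, if $\sigma_1\ge\sigma_2\ge\cdots\ge 0$ are the singular values of $\mathcal L$ acting on $\mathcal H$ (the eigenvalues of $(\mathcal L^*\mathcal L)^{1/2}$, repeated according to multiplicity, followed by zeros if only finitely many are positive), then $$\sigma_k\le C\sup_{0<x\le 1/k}\frac{w(Ax)}{w(\theta A x)}\qquad\text{for all integers } k\ge 1.$$ -/

import Mathlib

open scoped ContDiff

namespace CircleDC

/-- Smooth complex functions on the circle `ℝ / ℤ`, as a subspace of all functions. -/
def smoothSubmodule : Submodule ℂ (UnitAddCircle → ℂ) where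
  carrier := {f | ContDiff ℝ ∞ (fun t : ℝ => f (t : UnitAddCircle))}
  add_mem' := by
    intro f g hf hg
    rw [Set.mem_ofPred_eq] at hf hg
    change ContDiff ℝ ∞ (fun t : ℝ => f (t : UnitAddCircle) + g (t : UnitAddCircle))
    exact hf.add hg
  zero_mem' := by
    change ContDiff ℝ ∞ (fun _ : ℝ => (0 : ℂ))
    exact contDiff_const
  smul_mem' := by
    intro c f hf
    rw [Set.mem_ofPred_eq] at hf
    change ContDiff ℝ ∞ (fun t : ℝ => c * f (t : UnitAddCircle))
    exact contDiff_const.mul hf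

/-- The space `C^∞(ℝ / ℤ)` of smooth complex functions on the circle. -/
def SmoothFun : Type := smoothSubmodule

noncomputable instance : AddCommGroup SmoothFun :=
  inferInstanceAs (AddCommGroup smoothSubmodule)

noncomputable instance : Module ℂ SmoothFun :=
  inferInstanceAs (Module ℂ smoothSubmodule)

instance : CoeFun SmoothFun (fun _ => UnitAddCircle → ℂ) := ⟨fun f => f.1⟩

/-- The usual Fréchet topology of `C^∞(ℝ / ℤ)`: uniform convergence of the derivatives
of every order. -/
noncomputable instance : TopologicalSpace SmoothFun :=
  TopologicalSpace.induced
    (fun (f : SmoothFun) (k : ℕ) =>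
      UniformFun.ofFun (iteratedDeriv k (fun t : ℝ => f (t : UnitAddCircle))))
    (inferInstance : TopologicalSpace (ℕ → UniformFun ℝ ℂ))

/-- Trigonometric polynomials: the linear span of `x ↦ exp (2 i π n x)`, `n ∈ ℤ`. -/
noncomputable def trigPolynomials : Submodule ℂ (UnitAddCircle → ℂ) :=
  Submodule.span ℂ (Set.range fun n : ℤ => (fourier n : UnitAddCircle → ℂ))

/-- The smooth function `F` on the line is a lift of the circle map `T`. -/
def IsSmoothLift (T : UnitAddCircle → UnitAddCircle) (F : ℝ → ℝ) : Prop :=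
  ContDiff ℝ ∞ F ∧ ∀ t : ℝ, T (t : UnitAddCircle) = (F t : UnitAddCircle)

/-- A `C^∞` map of the circle to itself. -/
def IsSmoothCircleMap (T : UnitAddCircle → UnitAddCircle) : Prop :=
  ∃ F : ℝ → ℝ, IsSmoothLift T F

/-- The derivative `T' : ℝ / ℤ → ℝ` of a circle map in the usual parallelization: the difference
`T (y + t) - T y` in `ℝ / ℤ` is read in `[-1/2, 1/2)` and differentiated in `t` at `0`. -/
noncomputable def circleDeriv (T : UnitAddCircle → UnitAddCircle) (y : UnitAddCircle) : ℝ :=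
  deriv (fun t : ℝ =>
    ((AddCircle.equivIco (1 : ℝ) (-1 / 2) (T (y + (t : UnitAddCircle)) - T y) :
      Set.Ico (-1 / 2 : ℝ) (-1 / 2 + 1)) : ℝ)) 0

/-- The derivative of a circle map is the derivative of any of its lifts. -/
theorem circleDeriv_coe {T : UnitAddCircle → UnitAddCircle} {F : ℝ → ℝ}
    (hF : IsSmoothLift T F) (s : ℝ) : circleDeriv T (s : UnitAddCircle) = deriv F s := by
  have hc : Continuous fun t : ℝ => F (s + t) - F s :=
    (hF.1.continuous.comp (continuous_const.add continuous_id)).sub continuous_const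
  have hmem : ∀ᶠ t in nhds (0 : ℝ), F (s + t) - F s ∈ Set.Ioo (-1 / 2 : ℝ) (-1 / 2 + 1) := by
    refine hc.continuousAt.eventually_mem (Ioo_mem_nhds ?_ ?_) <;> norm_num
  have heq : (fun t : ℝ =>
      ((AddCircle.equivIco (1 : ℝ) (-1 / 2)
        (T ((s : UnitAddCircle) + (t : UnitAddCircle)) - T s) :
        Set.Ico (-1 / 2 : ℝ) (-1 / 2 + 1)) : ℝ)) =ᶠ[nhds 0] fun t => F (s + t) - F s := by
    filter_upwards [hmem] with t ht
    have h1 : T ((s : UnitAddCircle) + (t : UnitAddCircle)) - T s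
        = ((F (s + t) - F s : ℝ) : UnitAddCircle) := by
      rw [← AddCircle.coe_add, hF.2, hF.2, ← AddCircle.coe_sub]
    rw [h1, AddCircle.equivIco_coe_eq (Set.Ioo_subset_Ico_self ht)]
  rw [circleDeriv, heq.deriv_eq, deriv_sub_const, deriv_comp_const_add, add_zero]

/-- The Denjoy–Carleman class `C^M` on the circle. -/
def DenjoyCarleman (M : ℕ → ℝ) (f : UnitAddCircle → ℂ) : Prop :=
  f ∈ smoothSubmodule ∧ ∃ C R : ℝ, 0 < C ∧ 0 < R ∧ ∀ (k : ℕ) (t : ℝ),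
    ‖iteratedDeriv k (fun s : ℝ => f (s : UnitAddCircle)) t‖
      ≤ C * R ^ k * (k.factorial : ℝ) * M k

/-- The weight `w(x) = inf_k x^k k! M_k`. -/
noncomputable def weight (M : ℕ → ℝ) (x : ℝ) : ℝ :=
  ⨅ k : ℕ, x ^ k * (k.factorial : ℝ) * M k

/-- The transfer operator `(L φ)(x) = ∑_{T y = x} φ(y) / |T'(y)|`. -/
noncomputable def transferOperator (T : UnitAddCircle → UnitAddCircle)
    (φ : UnitAddCircle → ℂ) (x : UnitAddCircle) : ℂ :=
  ∑ᶠ y ∈ {y | T y = x}, ((1 / |circleDeriv T y| : ℝ) : ℂ) * φ y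

section SingularValues

variable {H : Type*} [NormedAddCommGroup H] [InnerProductSpace ℂ H] [CompleteSpace H]

/-- The span of all eigenvectors of `A* A` for eigenvalues `t ^ 2` with `t > s`. For `s ≥ 0` its
dimension is the number, with multiplicity, of eigenvalues of `(A* A)^(1/2)` that exceed `s`. -/
noncomputable def singularSpace (A : H →L[ℂ] H) (s : ℝ) : Submodule ℂ H :=
  ⨆ t ∈ Set.Ioi s, Module.End.eigenspace
    ((ContinuousLinearMap.adjoint A * A : H →L[ℂ] H) : H →ₗ[ℂ] H) ((t : ℂ) ^ 2)

/-- For `k ≥ 1`, the `k`-th largest eigenvalue, counted with multiplicity, of the operator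
`(A* A)^(1/2)` of a compact operator `A` (and `0` if it has fewer than `k` positive ones): the
least `s ≥ 0` such that fewer than `k` eigenvalues exceed `s`. The numbering starts at `k = 1`. -/
noncomputable def singularValue (A : H →L[ℂ] H) (k : ℕ) : ℝ :=
  sInf {s : ℝ | 0 ≤ s ∧ Module.rank ℂ (singularSpace A s) < k}

end SingularValues

end CircleDC

namespace CircleDC

open scoped ENNReal lp

/-! ### The weight function -/

section Weight

variable {M : ℕ → ℝ}

/-- The defining properties of the sequences used below, apart from logarithmic convexity. -/
structure IsWeightSeq (M : ℕ → ℝ) : Prop where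
  zero : M 0 = 1
  mono : Monotone M

theorem IsWeightSeq.one_le (hM : IsWeightSeq M) (k : ℕ) : 1 ≤ M k :=
  hM.zero ▸ hM.mono (Nat.zero_le k)

theorem IsWeightSeq.pos (hM : IsWeightSeq M) (k : ℕ) : 0 < M k :=
  one_pos.trans_le (hM.one_le k)

theorem IsWeightSeq.term_pos (hM : IsWeightSeq M) {x : ℝ} (hx : 0 < x) (k : ℕ) :
    0 < x ^ k * (k.factorial : ℝ) * M k := by
  have := hM.pos k
  positivity

theorem IsWeightSeq.weight_le (hM : IsWeightSeq M) {x : ℝ} (hx : 0 < x) (k : ℕ) :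
    weight M x ≤ x ^ k * (k.factorial : ℝ) * M k :=
  ciInf_le ⟨0, by rintro _ ⟨k, rfl⟩; exact (hM.term_pos hx k).le⟩ k

theorem IsWeightSeq.weight_pos (hM : IsWeightSeq M) {x : ℝ} (hx : 0 < x) : 0 < weight M x := by
  refine (Real.exp_pos (-x⁻¹)).trans_le (le_ciInf fun k => ?_)
  have h1 := Real.pow_div_factorial_le_exp x⁻¹ (inv_pos.2 hx).le k
  have hk : (0 : ℝ) < k.factorial := by positivity
  rw [Real.exp_neg, inv_le_comm₀ (Real.exp_pos _) (hM.term_pos hx k)]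
  refine le_trans ?_ h1
  rw [mul_inv, mul_inv, ← inv_pow, div_eq_mul_inv]
  exact mul_le_of_le_one_right (by positivity) (inv_le_one_of_one_le₀ (hM.one_le k))

theorem IsWeightSeq.weight_mono (hM : IsWeightSeq M) {x y : ℝ} (hx : 0 < x) (hxy : x ≤ y) :
    weight M x ≤ weight M y := by
  refine le_ciInf fun k => (hM.weight_le hx k).trans ?_
  have := (hM.pos k).le
  gcongr

theorem IsWeightSeq.mul_weight_le (hM : IsWeightSeq M) {θ : ℝ} (hθ : 1 ≤ θ) (J : ℕ) {x : ℝ}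
    (hx : 0 < x) (hx1 : x ≤ 1) (hxJ : x * (θ ^ J * J.factorial * M J) ≤ 1) :
    θ ^ J * weight M x ≤ weight M (θ * x) := by
  have hθ0 : 0 < θ := by linarith
  refine le_ciInf fun k => ?_
  have hk1 : (1 : ℝ) ≤ k.factorial := by exact_mod_cast Nat.one_le_iff_ne_zero.2 k.factorial_ne_zero
  have hMk := hM.one_le k
  rcases le_or_gt J k with h | h
  · calc θ ^ J * weight M x ≤ θ ^ k * (x ^ k * (k.factorial : ℝ) * M k) := by
          gcongr
          · exact (hM.weight_pos hx).le
          · exact hM.weight_le hx k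
      _ = _ := by rw [mul_pow]; ring
  · obtain ⟨j, rfl⟩ : ∃ j, J = k + j + 1 := ⟨J - k - 1, by omega⟩
    calc θ ^ (k + j + 1) * weight M x
        ≤ θ ^ (k + j + 1) * (x ^ (k + j + 1) * ((k + j + 1).factorial : ℝ) * M (k + j + 1)) := by
          gcongr; exact hM.weight_le hx _
      _ = x ^ (k + j) * (x * (θ ^ (k + j + 1) * ((k + j + 1).factorial : ℝ) * M (k + j + 1))) := by
          rw [pow_succ x]; ring
      _ ≤ x ^ (k + j) * 1 := by gcongr
      _ ≤ x ^ k := by rw [mul_one]; exact pow_le_pow_of_le_one hx.le hx1 (by omega)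
      _ = 1 * x ^ k * 1 * 1 := by ring
      _ ≤ θ ^ k * x ^ k * k.factorial * M k := by
          gcongr; exact one_le_pow₀ hθ
      _ = _ := by rw [mul_pow]

/-- The supremum that bounds the singular values. -/
noncomputable def weightSup (M : ℕ → ℝ) (A θ : ℝ) (k : ℕ) : ℝ :=
  ⨆ x : Set.Ioc (0 : ℝ) (1 / (k : ℝ)), weight M (A * x) / weight M (θ * A * x)

theorem IsWeightSeq.ratio_le_one (hM : IsWeightSeq M) {A θ x : ℝ} (hA : 0 < A) (hθ : 1 ≤ θ)
    (hx : 0 < x) : weight M (A * x) / weight M (θ * A * x) ≤ 1 := by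
  have hθ0 : 0 < θ := by linarith
  rw [div_le_one (hM.weight_pos (by positivity)), mul_assoc]
  exact hM.weight_mono (by positivity) (le_mul_of_one_le_left (by positivity) hθ)

theorem IsWeightSeq.le_weightSup (hM : IsWeightSeq M) {A θ : ℝ} (hA : 0 < A) (hθ : 1 ≤ θ)
    {k : ℕ} {x : ℝ} (hx : 0 < x) (hxk : x ≤ 1 / (k : ℝ)) :
    weight M (A * x) / weight M (θ * A * x) ≤ weightSup M A θ k :=
  le_ciSup (f := fun x : Set.Ioc (0 : ℝ) (1 / (k : ℝ)) =>
    weight M (A * x) / weight M (θ * A * x))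
    ⟨1, by rintro _ ⟨y, rfl⟩; exact hM.ratio_le_one hA hθ y.2.1⟩ ⟨x, hx, hxk⟩

theorem IsWeightSeq.weightSup_pos (hM : IsWeightSeq M) {A θ : ℝ} (hA : 0 < A) (hθ : 1 ≤ θ)
    {k : ℕ} (hk : 1 ≤ k) : 0 < weightSup M A θ k := by
  have hθ0 : 0 < θ := by linarith
  have hk0 : (0 : ℝ) < 1 / k := by positivity
  exact (div_pos (hM.weight_pos (by positivity)) (hM.weight_pos (by positivity))).trans_le
    (hM.le_weightSup hA hθ hk0 le_rfl)

theorem IsWeightSeq.tendsto_weightSup (hM : IsWeightSeq M) {A θ : ℝ} (hA : 0 < A) (hθ : 1 < θ) :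
    Filter.Tendsto (weightSup M A θ) Filter.atTop (nhds 0) := by
  have hθ0 : 0 < θ := by linarith
  rw [Metric.tendsto_atTop]
  intro ε hε
  obtain ⟨J, hJ⟩ := exists_pow_lt_of_lt_one hε (inv_lt_one_of_one_lt₀ hθ)
  set c : ℝ := max A (A * (θ ^ J * J.factorial * M J)) with hc
  obtain ⟨K, hK⟩ := exists_nat_ge c
  refine ⟨K + 1, fun k hk => ?_⟩
  have hk1 : (K : ℝ) + 1 ≤ k := by exact_mod_cast hk
  have hk0 : (0 : ℝ) < k := lt_of_lt_of_le (by positivity) hk1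
  rw [Real.dist_eq, sub_zero, abs_of_pos (hM.weightSup_pos hA hθ.le (by omega))]
  refine lt_of_le_of_lt ?_ hJ
  have : Nonempty (Set.Ioc (0 : ℝ) (1 / (k : ℝ))) := ⟨⟨1 / k, by positivity, le_rfl⟩⟩
  refine ciSup_le fun x => ?_
  obtain ⟨x, hx0, hx⟩ := x
  have hck : c ≤ k := by linarith
  have hcx : c * x ≤ 1 := by
    calc c * x ≤ k * (1 / k) := by gcongr
      _ = 1 := by field_simp
  have hw := hM.mul_weight_le hθ.le J (x := A * x) (by positivity)
    ((mul_le_mul_of_nonneg_right (le_max_left _ _) hx0.le).trans hcx)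
    (le_trans (by nlinarith [mul_le_mul_of_nonneg_right (le_max_right A
      (A * (θ ^ J * J.factorial * M J))) hx0.le]) hcx)
  dsimp only
  rw [div_le_iff₀ (hM.weight_pos (by positivity)), inv_pow, inv_mul_eq_div,
    le_div_iff₀ (by positivity), mul_comm, mul_assoc θ]
  exact hw

/-- The dual weight `sup_{k ≥ 1} r ^ (k - 1) / (B ^ k k! M_k)`. -/
noncomputable def dualWeight (M : ℕ → ℝ) (B r : ℝ) : ℝ :=
  ⨆ k : ℕ, r ^ k / (B ^ (k + 1) * (k + 1).factorial * M (k + 1))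

variable {B : ℝ}

theorem IsWeightSeq.bddAbove_dualWeight (hM : IsWeightSeq M) (hB : 0 < B) {r : ℝ} (hr : 0 ≤ r) :
    BddAbove (Set.range fun k : ℕ => r ^ k / (B ^ (k + 1) * (k + 1).factorial * M (k + 1))) := by
  refine ⟨Real.exp (r / B) / B, ?_⟩
  rintro _ ⟨k, rfl⟩
  have h1 := Real.pow_div_factorial_le_exp (r / B) (by positivity) k
  have h2 : (k.factorial : ℝ) ≤ (k + 1).factorial := by
    exact_mod_cast Nat.factorial_le (Nat.le_succ k)
  have h3 := hM.one_le (k + 1)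
  have hf : (0 : ℝ) < k.factorial := by positivity
  calc r ^ k / (B ^ (k + 1) * (k + 1).factorial * M (k + 1))
      ≤ r ^ k / (B ^ (k + 1) * k.factorial * 1) := by gcongr
    _ = (r / B) ^ k / k.factorial / B := by rw [div_pow, pow_succ]; field_simp
    _ ≤ _ := by gcongr

theorem IsWeightSeq.le_dualWeight (hM : IsWeightSeq M) (hB : 0 < B) {r : ℝ} (hr : 0 ≤ r) (k : ℕ) :
    r ^ k / (B ^ (k + 1) * (k + 1).factorial * M (k + 1)) ≤ dualWeight M B r :=
  le_ciSup (hM.bddAbove_dualWeight hB hr) k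

theorem IsWeightSeq.dualWeight_pos (hM : IsWeightSeq M) (hB : 0 < B) {r : ℝ} (hr : 0 ≤ r) :
    0 < dualWeight M B r := by
  refine lt_of_lt_of_le ?_ (hM.le_dualWeight hB hr 0)
  have := hM.pos (0 + 1)
  rw [pow_zero]
  positivity

theorem IsWeightSeq.dualWeight_mono (hM : IsWeightSeq M) (hB : 0 < B) {r s : ℝ} (hr : 0 ≤ r)
    (hrs : r ≤ s) : dualWeight M B r ≤ dualWeight M B s := by
  refine ciSup_le fun k => le_trans ?_ (hM.le_dualWeight hB (hr.trans hrs) k)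
  have := hM.pos (k + 1)
  gcongr

theorem IsWeightSeq.dualWeight_le (hM : IsWeightSeq M) (hB : 0 < B) {r : ℝ} (hr : 0 < r) :
    dualWeight M B r ≤ 1 / (r * weight M (B / r)) := by
  refine ciSup_le fun k => ?_
  have hw := hM.weight_pos (x := B / r) (by positivity)
  have h := hM.weight_le (x := B / r) (by positivity) (k + 1)
  have := hM.pos (k + 1)
  rw [div_le_div_iff₀ (by positivity) (by positivity), one_mul]
  calc r ^ k * (r * weight M (B / r)) = r ^ (k + 1) * weight M (B / r) := by ring
    _ ≤ r ^ (k + 1) * ((B / r) ^ (k + 1) * (k + 1).factorial * M (k + 1)) := by gcongr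
    _ = _ := by rw [div_pow]; field_simp

theorem IsWeightSeq.inv_dualWeight_le (hM : IsWeightSeq M) (hB : 0 < B) {r : ℝ} (hr : 1 ≤ r) :
    1 / dualWeight M B r ≤ max 1 (B * M 1) * r * weight M (B / r) := by
  have hr0 : 0 < r := by linarith
  have hd := hM.dualWeight_pos hB hr0.le
  have hC : 0 < max 1 (B * M 1) := lt_max_of_lt_left one_pos
  rw [div_le_iff₀ hd, mul_assoc, mul_assoc, ← div_le_iff₀' hC, ← div_le_iff₀' hr0,
    ← div_le_iff₀ hd]
  refine le_ciInf fun k => ?_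
  have h1 := hM.pos 1
  rcases k with _ | k
  · have h := hM.le_dualWeight hB hr0.le 0
    simp only [pow_zero, zero_add, pow_one, Nat.factorial_one, Nat.cast_one, mul_one] at h
    simp only [pow_zero, Nat.factorial_zero, Nat.cast_one, hM.zero, mul_one]
    rw [div_le_one hd]
    refine le_trans ?_ h
    rw [div_div, div_le_div_iff₀ (by positivity) (by positivity), one_mul, one_mul]
    nlinarith [le_max_right 1 (B * M 1)]
  · have h := hM.le_dualWeight hB hr0.le k
    have h2 := hM.pos (k + 1)
    rw [div_le_iff₀ hd]
    calc 1 / max 1 (B * M 1) / r ≤ 1 / 1 / r := by gcongr; exact le_max_left _ _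
      _ = (B / r) ^ (k + 1) * (k + 1).factorial * M (k + 1)
          * (r ^ k / (B ^ (k + 1) * (k + 1).factorial * M (k + 1))) := by
            rw [div_pow, pow_succ r]; field_simp
      _ ≤ _ := by gcongr

theorem IsWeightSeq.summable_pow_div_dualWeight (hM : IsWeightSeq M) (hB : 0 < B) (j : ℕ) :
    Summable fun n : ℤ => |(n : ℝ)| ^ j / dualWeight M B |(n : ℝ)| := by
  have hp := hM.pos (j + 2 + 1)
  set c : ℝ := B ^ (j + 2 + 1) * (j + 2 + 1).factorial * M (j + 2 + 1) with hc
  have hc0 : 0 < c := by positivity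
  have hs : Summable fun n : ℤ => c * (1 / (n : ℝ) ^ 2) :=
    (Real.summable_one_div_int_pow.2 one_lt_two).mul_left _
  refine hs.of_norm_bounded_eventually ?_
  have : ({0}ᶜ : Set ℤ) ∈ Filter.cofinite := (Set.finite_singleton 0).compl_mem_cofinite
  filter_upwards [this] with n hn
  have hn0 : 0 < |(n : ℝ)| := abs_pos.2 (by exact_mod_cast hn)
  have hd := hM.dualWeight_pos hB (abs_nonneg (n : ℝ))
  have h := hM.le_dualWeight hB (abs_nonneg (n : ℝ)) (j + 2)
  rw [Real.norm_of_nonneg (by positivity), ← sq_abs (n : ℝ), mul_one_div,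
    div_le_div_iff₀ hd (by positivity), ← pow_add, ← div_le_iff₀' hc0]
  exact h

end Weight

/-! ### Summation by parts -/

theorem exists_tsum_eq_of_monotone {W : ℕ → ℝ≥0∞} (hW : Monotone W) :
    ∃ b : ℕ → ℝ≥0∞, ∀ n, W n = ∑' i, if i ≤ n then b i else 0 := by
  refine ⟨fun i => Nat.casesOn i (W 0) fun j => W (j + 1) - W j, fun n => ?_⟩
  rw [tsum_eq_sum (s := Finset.range (n + 1))
    (fun i hi => if_neg (by rw [Finset.mem_range] at hi; omega)), Finset.sum_congr rfl
    (fun i hi => if_pos (by rw [Finset.mem_range] at hi; omega))]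
  induction n with
  | zero => simp
  | succ n ih => rw [Finset.sum_range_succ, ← ih, add_tsub_cancel_of_le (hW n.le_succ)]

theorem tsum_weight_mul_eq {ι : Type*} (p : ι → ℕ) (b : ℕ → ℝ≥0∞) (X : ι → ℝ≥0∞) (N : ℕ) :
    ∑' n, (if N ≤ p n then (∑' i, if i ≤ p n then b i else 0) * X n else 0)
      = ∑' i, b i * ∑' n, if max i N ≤ p n then X n else 0 := by
  simp_rw [← ENNReal.tsum_mul_left]
  rw [ENNReal.tsum_comm]
  refine tsum_congr fun n => ?_
  split_ifs with h
  · rw [← ENNReal.tsum_mul_right]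
    refine tsum_congr fun i => ?_
    by_cases hi : i ≤ p n <;> simp [hi, h]
  · simp [h]

/-- If every tail of `X` is controlled by tails of `Y` and of `Z`, then so are the weighted
tails, for every monotone weight. -/
theorem tsum_weight_mul_le {W : ℕ → ℝ≥0∞} (hW : Monotone W) {X Y Z : ℤ → ℝ≥0∞} {D E : ℝ≥0∞}
    {θ : ℝ} (hθ : 0 < θ)
    (h : ∀ r : ℕ, (∑' n : ℤ, if r ≤ n.natAbs then X n else 0)
      ≤ D * (∑' m : ℤ, if θ * r < |(m : ℝ)| then Y m else 0)
        + E * ∑' n : ℤ, if r ≤ n.natAbs then Z n else 0) (N : ℕ) :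
    (∑' n : ℤ, if N ≤ n.natAbs then W n.natAbs * X n else 0)
      ≤ D * (∑' m : ℤ, if θ * N < |(m : ℝ)| then W ⌊|(m : ℝ)| / θ⌋₊ * Y m else 0)
        + E * ∑' n : ℤ, if N ≤ n.natAbs then W n.natAbs * Z n else 0 := by
  obtain ⟨b, hb⟩ := exists_tsum_eq_of_monotone hW
  simp_rw [hb]
  rw [tsum_weight_mul_eq Int.natAbs b X N, tsum_weight_mul_eq Int.natAbs b Z N]
  calc ∑' i, b i * ∑' n : ℤ, (if max i N ≤ n.natAbs then X n else 0)
      ≤ ∑' i, (D * (b i * ∑' m : ℤ, if θ * (max i N : ℕ) < |(m : ℝ)| then Y m else 0)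
        + E * (b i * ∑' n : ℤ, if max i N ≤ n.natAbs then Z n else 0)) := by
        refine ENNReal.tsum_le_tsum fun i => ?_
        rw [mul_left_comm D, mul_left_comm E, ← mul_add]
        gcongr
        exact h _
    _ = D * (∑' i, b i * ∑' m : ℤ, if θ * (max i N : ℕ) < |(m : ℝ)| then Y m else 0)
        + E * ∑' i, b i * ∑' n : ℤ, if max i N ≤ n.natAbs then Z n else 0 := by
        rw [ENNReal.tsum_add, ENNReal.tsum_mul_left, ENNReal.tsum_mul_left]
    _ ≤ _ := by
        gcongr
        simp_rw [← ENNReal.tsum_mul_left]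
        rw [ENNReal.tsum_comm]
        refine ENNReal.tsum_le_tsum fun m => ?_
        split_ifs with hN
        · rw [← ENNReal.tsum_mul_right]
          refine ENNReal.tsum_le_tsum fun i => ?_
          split_ifs with h1 h2 h2
          · exact le_rfl
          · refine absurd (Nat.le_floor ?_) h2
            rw [le_div_iff₀ hθ, mul_comm]
            refine le_trans ?_ h1.le
            gcongr
            exact le_max_left _ _
          · simp
          · simp
        · refine le_of_eq (ENNReal.tsum_eq_zero.2 fun i => ?_)
          rw [if_neg, mul_zero]
          refine fun h1 => hN (lt_of_le_of_lt ?_ h1)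
          gcongr
          exact le_max_right _ _

/-! ### Singular values and approximation by operators of finite rank -/

section Singular

variable {H : Type*} [NormedAddCommGroup H] [InnerProductSpace ℂ H] [CompleteSpace H]

theorem isSymmetric_adjoint_mul (A : H →L[ℂ] H) :
    ((ContinuousLinearMap.adjoint A * A : H →L[ℂ] H) : H →ₗ[ℂ] H).IsSymmetric := by
  intro x y
  change inner ℂ (ContinuousLinearMap.adjoint A (A x)) y
    = inner ℂ x (ContinuousLinearMap.adjoint A (A y))
  rw [ContinuousLinearMap.adjoint_inner_left, ContinuousLinearMap.adjoint_inner_right]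

theorem norm_lt_of_mem_singularSpace (A : H →L[ℂ] H) {s : ℝ} (hs : 0 ≤ s) {v : H}
    (hv : v ∈ singularSpace A s) (hv0 : v ≠ 0) : s * ‖v‖ < ‖A v‖ := by
  set Q : H →ₗ[ℂ] H := ((ContinuousLinearMap.adjoint A * A : H →L[ℂ] H) : H →ₗ[ℂ] H) with hQ
  have horth : ∀ t u : Set.Ioi s, t ≠ u →
      ∀ x ∈ Module.End.eigenspace Q (((t : ℝ) : ℂ) ^ 2),
      ∀ y ∈ Module.End.eigenspace Q (((u : ℝ) : ℂ) ^ 2), inner ℂ x y = 0 := by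
    intro t u htu x hx y hy
    have hne : ((t : ℝ) : ℂ) ^ 2 ≠ ((u : ℝ) : ℂ) ^ 2 := by
      intro h
      have h' : (t : ℝ) ^ 2 = (u : ℝ) ^ 2 := by exact_mod_cast h
      exact htu (Subtype.ext ((pow_left_inj₀ (hs.trans t.2.le) (hs.trans u.2.le) two_ne_zero).1 h'))
    exact (isSymmetric_adjoint_mul A).orthogonalFamily_eigenspaces hne ⟨x, hx⟩ ⟨y, hy⟩
  have hv' : v ∈ ⨆ t : Set.Ioi s, Module.End.eigenspace Q (((t : ℝ) : ℂ) ^ 2) := by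
    rw [singularSpace, iSup_subtype'] at hv
    exact hv
  obtain ⟨f, hf, hfv⟩ := (Submodule.mem_iSup_iff_exists_finsupp _ _).1 hv'
  have hfv' : v = ∑ t ∈ f.support, f t := hfv.symm
  have hQf : ∀ t, Q (f t) = (((t : ℝ) : ℂ) ^ 2) • f t :=
    fun t => Module.End.mem_eigenspace_iff.1 (hf t)
  have hnorm : ((‖v‖ ^ 2 : ℝ) : ℂ) = ∑ t ∈ f.support, ((‖f t‖ ^ 2 : ℝ) : ℂ) := by
    have : ((‖v‖ ^ 2 : ℝ) : ℂ) = inner ℂ v v := by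
      rw [inner_self_eq_norm_sq_to_K]; push_cast; rfl
    rw [this, hfv', sum_inner]
    refine Finset.sum_congr rfl fun t ht => ?_
    rw [inner_sum, Finset.sum_eq_single t, inner_self_eq_norm_sq_to_K]
    · push_cast; rfl
    · exact fun u _ hu => horth t u hu.symm _ (hf t) _ (hf u)
    · exact fun h => absurd ht h
  have hnormA : ((‖A v‖ ^ 2 : ℝ) : ℂ) = ∑ t ∈ f.support, (((t : ℝ) ^ 2 * ‖f t‖ ^ 2 : ℝ) : ℂ) := by
    have : ((‖A v‖ ^ 2 : ℝ) : ℂ) = inner ℂ v (Q v) := by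
      change _ = inner ℂ v (ContinuousLinearMap.adjoint A (A v))
      rw [ContinuousLinearMap.adjoint_inner_right, inner_self_eq_norm_sq_to_K]; push_cast; rfl
    rw [this, hfv', map_sum, sum_inner]
    refine Finset.sum_congr rfl fun t ht => ?_
    rw [inner_sum, Finset.sum_eq_single t, hQf, inner_smul_right, inner_self_eq_norm_sq_to_K]
    · push_cast; rfl
    · intro u _ hu
      rw [hQf, inner_smul_right, horth t u hu.symm _ (hf t) _ (hf u), mul_zero]
    · exact fun h => absurd ht h
  have hnorm' : ‖v‖ ^ 2 = ∑ t ∈ f.support, ‖f t‖ ^ 2 := by exact_mod_cast hnorm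
  have hnormA' : ‖A v‖ ^ 2 = ∑ t ∈ f.support, (t : ℝ) ^ 2 * ‖f t‖ ^ 2 := by exact_mod_cast hnormA
  have hne : f.support.Nonempty := by
    rw [Finset.nonempty_iff_ne_empty]
    rintro h
    rw [h, Finset.sum_empty] at hfv'
    exact hv0 hfv'
  refine lt_of_pow_lt_pow_left₀ 2 (norm_nonneg _) ?_
  rw [mul_pow, hnorm', hnormA', Finset.mul_sum]
  refine Finset.sum_lt_sum_of_nonempty hne fun t ht => ?_
  have h1 : 0 < ‖f t‖ := norm_pos_iff.2 (Finsupp.mem_support_iff.1 ht)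
  have h2 : s < t := t.2
  gcongr

/-- If `A` has norm at most `s` on the kernel of a map of rank less than `k`, then its `k`-th
singular value is at most `s`. -/
theorem singularValue_le_of_norm_le (A : H →L[ℂ] H) {s : ℝ} (hs : 0 ≤ s) {k : ℕ} {η : Type}
    [Fintype η] (hη : Fintype.card η < k) (p : H →ₗ[ℂ] (η → ℂ))
    (h : ∀ v, p v = 0 → ‖A v‖ ≤ s * ‖v‖) : singularValue A k ≤ s := by
  refine csInf_le ⟨0, fun t ht => ht.1⟩ ⟨hs, ?_⟩
  have hinj : Function.Injective (p.comp (singularSpace A s).subtype) := by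
    rw [← LinearMap.ker_eq_bot, LinearMap.ker_eq_bot']
    intro v hv
    by_contra hv0
    exact absurd (h v hv) (not_le.2 (norm_lt_of_mem_singularSpace A hs v.2
      (fun h => hv0 (Subtype.ext h))))
  have hr := LinearMap.lift_rank_le_of_injective _ hinj
  rw [rank_fun'] at hr
  have hr' : Module.rank ℂ (singularSpace A s) ≤ (Fintype.card η : Cardinal) := by
    simpa using hr
  exact lt_of_le_of_lt hr' (by exact_mod_cast hη)

end Singular

section Truncation

/-- The Hilbert space `ℓ²(ℤ)`. -/
abbrev SeqSpace : Type := lp (fun _ : ℤ => ℂ) 2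

theorem SeqSpace.norm_apply_le (h : SeqSpace) (n : ℤ) : ‖h n‖ ≤ ‖h‖ :=
  lp.norm_apply_le_norm (by norm_num) h n

theorem SeqSpace.hasSum_norm_sq (h : SeqSpace) : HasSum (fun n => ‖h n‖ ^ 2) (‖h‖ ^ 2) := by
  have := lp.hasSum_norm (p := 2) (by norm_num) h
  simpa using this

/-- Coordinates as a continuous linear form. -/
noncomputable def SeqSpace.coord (n : ℤ) : SeqSpace →L[ℂ] ℂ :=
  LinearMap.mkContinuous
    { toFun := fun h => h n
      map_add' := fun _ _ => rfl
      map_smul' := fun _ _ => rfl } 1 (fun h => by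
        rw [one_mul]; exact SeqSpace.norm_apply_le h n)

@[simp] theorem SeqSpace.coord_apply (n : ℤ) (h : SeqSpace) : SeqSpace.coord n h = h n := rfl

/-- The projection onto the coordinates of index less than `N`. -/
noncomputable def SeqSpace.trunc (N : ℕ) : SeqSpace →L[ℂ] SeqSpace :=
  ∑ n ∈ Finset.Ioo (-(N : ℤ)) N,
    (ContinuousLinearMap.toSpanSingleton ℂ (lp.single 2 n (1 : ℂ) : SeqSpace)).comp
      (SeqSpace.coord n)

theorem SeqSpace.trunc_apply (N : ℕ) (h : SeqSpace) (n : ℤ) :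
    SeqSpace.trunc N h n = if n.natAbs < N then h n else 0 := by
  have h1 : SeqSpace.trunc N h
      = ∑ m ∈ Finset.Ioo (-(N : ℤ)) N, h m • (lp.single 2 m (1 : ℂ) : SeqSpace) := by
    simp [SeqSpace.trunc]
  have h2 : ∀ m, (h m • (lp.single 2 m (1 : ℂ) : SeqSpace)) n = if m = n then h n else 0 := by
    intro m
    rw [lp.coeFn_smul, Pi.smul_apply, lp.single_apply]
    by_cases hmn : n = m
    · subst hmn; simp
    · rw [if_neg (Ne.symm hmn)]; simp [hmn]
  rw [h1, lp.coeFn_sum, Finset.sum_apply, Finset.sum_congr rfl (fun m _ => h2 m),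
    Finset.sum_ite_eq']
  refine if_congr ?_ rfl rfl
  rw [Finset.mem_Ioo]; omega

theorem SeqSpace.isCompactOperator_trunc (N : ℕ) : IsCompactOperator (SeqSpace.trunc N) := by
  have : ∀ s : Finset ℤ, IsCompactOperator (∑ n ∈ s,
      (ContinuousLinearMap.toSpanSingleton ℂ (lp.single 2 n (1 : ℂ) : SeqSpace)).comp
        (SeqSpace.coord n) : SeqSpace →L[ℂ] SeqSpace) := by
    intro s
    induction s using Finset.induction_on with
    | empty => rw [Finset.sum_empty]; exact isCompactOperator_zero
    | insert a s ha ih =>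
      rw [Finset.sum_insert ha]
      exact ((isCompactOperator_of_locallyCompactSpace_dom
        (SeqSpace.coord a)).clm_comp (ContinuousLinearMap.toSpanSingleton ℂ
          (lp.single 2 a (1 : ℂ) : SeqSpace))).add ih
  exact this _

theorem SeqSpace.ofReal_norm_sq (h : SeqSpace) :
    ENNReal.ofReal (‖h‖ ^ 2) = ∑' n : ℤ, ENNReal.ofReal (‖h n‖ ^ 2) := by
  rw [← h.hasSum_norm_sq.tsum_eq,
    ENNReal.ofReal_tsum_of_nonneg (fun n => by positivity) h.hasSum_norm_sq.summable]

theorem SeqSpace.norm_le_of_tsum_le {h : SeqSpace} {s : ℝ} (hs : 0 ≤ s)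
    (hh : ∑' n : ℤ, ENNReal.ofReal (‖h n‖ ^ 2) ≤ ENNReal.ofReal (s ^ 2)) : ‖h‖ ≤ s := by
  rw [← SeqSpace.ofReal_norm_sq, ENNReal.ofReal_le_ofReal_iff (by positivity)] at hh
  exact (pow_le_pow_iff_left₀ (norm_nonneg _) hs two_ne_zero).1 hh

theorem SeqSpace.norm_sub_trunc_le {h : SeqSpace} {N : ℕ} {s : ℝ} (hs : 0 ≤ s)
    (hh : ∑' n : ℤ, (if N ≤ n.natAbs then ENNReal.ofReal (‖h n‖ ^ 2) else 0)
      ≤ ENNReal.ofReal (s ^ 2)) : ‖h - SeqSpace.trunc N h‖ ≤ s := by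
  refine SeqSpace.norm_le_of_tsum_le hs (le_trans (le_of_eq (tsum_congr fun n => ?_)) hh)
  rw [lp.coeFn_sub, Pi.sub_apply, SeqSpace.trunc_apply]
  by_cases hn : N ≤ n.natAbs
  · rw [if_pos hn, if_neg (not_lt.2 hn), sub_zero]
  · rw [if_neg hn, if_pos (not_le.1 hn)]; simp

/-- An operator on `ℓ²(ℤ)` whose tails are small is compact. -/
theorem SeqSpace.isCompactOperator_of_tail {L : SeqSpace →L[ℂ] SeqSpace} {s : ℕ → ℝ}
    (hs : ∀ N, 0 ≤ s N) (hlim : Filter.Tendsto s Filter.atTop (nhds 0))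
    (hL : ∀ N h, ‖L h - SeqSpace.trunc N (L h)‖ ≤ s N * ‖h‖) : IsCompactOperator L := by
  refine isCompactOperator_of_tendsto (l := Filter.atTop)
    (F := fun N => (SeqSpace.trunc N).comp L) ?_
    (Filter.Eventually.of_forall fun N => (SeqSpace.isCompactOperator_trunc N).comp_clm L)
  rw [tendsto_iff_norm_sub_tendsto_zero]
  refine squeeze_zero (fun _ => norm_nonneg _) (fun N => ?_) hlim
  refine ContinuousLinearMap.opNorm_le_bound _ (hs N) fun h => ?_
  rw [← norm_neg]
  simpa using hL N h

/-- A bound for the tails bounds the singular values. -/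
theorem SeqSpace.singularValue_le_of_tail {L : SeqSpace →L[ℂ] SeqSpace} {s : ℝ} (hs : 0 ≤ s)
    {N k : ℕ} (hk : 1 ≤ k) (hN : 2 * N ≤ k)
    (hL : ∀ h, ‖L h - SeqSpace.trunc N (L h)‖ ≤ s * ‖h‖) : singularValue L k ≤ s := by
  refine singularValue_le_of_norm_le L hs (η := Finset.Ioo (-(N : ℤ)) N) ?_
    (LinearMap.pi fun n => ((SeqSpace.coord n).comp L : SeqSpace →ₗ[ℂ] ℂ)) fun v hv => ?_
  · rw [Fintype.card_coe, Int.card_Ioo]; omega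
  · have h0 : SeqSpace.trunc N (L v) = 0 := by
      ext n
      rw [SeqSpace.trunc_apply]
      split_ifs with hn
      · exact congrFun hv ⟨n, Finset.mem_Ioo.2 (by omega)⟩
      · rfl
    have := hL v
    rwa [h0, sub_zero] at this

end Truncation

/-! ### Rapidly convergent Fourier series -/

theorem fourier_unit_apply (n : ℤ) (t : ℝ) :
    fourier n (t : UnitAddCircle) = Complex.exp (2 * Real.pi * Complex.I * n * t) := by
  rw [fourier_coe_apply]; simp

theorem norm_fourier_apply (n : ℤ) (x : UnitAddCircle) : ‖fourier n x‖ = 1 :=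
  Circle.norm_coe _

theorem iteratedDeriv_const_mul_exp (c a : ℂ) (k : ℕ) :
    iteratedDeriv k (fun t : ℝ => c * Complex.exp (a * t))
      = fun t : ℝ => c * a ^ k * Complex.exp (a * t) := by
  induction k with
  | zero => simp
  | succ k ih =>
    rw [iteratedDeriv_succ, ih]
    ext t
    have h1 : HasDerivAt (fun t : ℝ => a * (t : ℂ)) (a * 1) t :=
      (Complex.ofRealCLM.hasDerivAt).const_mul a
    rw [(h1.cexp.const_mul (c * a ^ k)).deriv]
    ring

theorem contDiff_fourier_term (c : ℂ) (n : ℤ) :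
    ContDiff ℝ ∞ (fun t : ℝ => c * fourier n (t : UnitAddCircle)) := by
  simp_rw [fourier_unit_apply]
  exact contDiff_const.mul (contDiff_const.mul Complex.ofRealCLM.contDiff).cexp

theorem norm_iteratedFDeriv_fourier_term (c : ℂ) (n : ℤ) (k : ℕ) (t : ℝ) :
    ‖iteratedFDeriv ℝ k (fun t : ℝ => c * fourier n (t : UnitAddCircle)) t‖
      = (2 * Real.pi) ^ k * (|(n : ℝ)| ^ k * ‖c‖) := by
  rw [norm_iteratedFDeriv_eq_norm_iteratedDeriv]
  simp_rw [fourier_unit_apply]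
  rw [iteratedDeriv_const_mul_exp]
  dsimp only
  rw [← fourier_unit_apply, norm_mul, norm_fourier_apply, norm_mul,
    norm_pow]
  have : ‖2 * (Real.pi : ℂ) * Complex.I * n‖ = 2 * Real.pi * |(n : ℝ)| := by
    simp [abs_of_pos Real.pi_pos]
  rw [this, mul_pow]; ring

/-- The sum of the Fourier series with coefficients `c`. -/
noncomputable def synth (c : ℤ → ℂ) (x : UnitAddCircle) : ℂ := ∑' n : ℤ, c n * fourier n x

/-- Decay of all polynomial orders. -/
def RapidDecay (c : ℤ → ℂ) : Prop := ∀ k : ℕ, Summable fun n : ℤ => |(n : ℝ)| ^ k * ‖c n‖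

namespace RapidDecay

variable {c : ℤ → ℂ}

theorem summable_norm (hc : RapidDecay c) : Summable fun n => ‖c n‖ := by
  simpa using hc 0

theorem contDiff_synth (hc : RapidDecay c) :
    ContDiff ℝ ∞ (fun t : ℝ => synth c (t : UnitAddCircle)) :=
  contDiff_tsum (𝕜 := ℝ) (N := ⊤) (fun n => contDiff_fourier_term (c n) n)
    (fun k _ => (hc k).mul_left ((2 * Real.pi) ^ k))
    (fun k n t _ => (norm_iteratedFDeriv_fourier_term (c n) n k t).le)

theorem norm_iteratedDeriv_synth_le (hc : RapidDecay c) (k : ℕ) (t : ℝ) :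
    ‖iteratedDeriv k (fun t : ℝ => synth c (t : UnitAddCircle)) t‖
      ≤ (2 * Real.pi) ^ k * ∑' n : ℤ, |(n : ℝ)| ^ k * ‖c n‖ := by
  rw [← norm_iteratedFDeriv_eq_norm_iteratedDeriv]
  have h := iteratedFDeriv_tsum (𝕜 := ℝ) (N := ⊤) (fun n => contDiff_fourier_term (c n) n)
    (fun k _ => (hc k).mul_left ((2 * Real.pi) ^ k))
    (fun k n t _ => (norm_iteratedFDeriv_fourier_term (c n) n k t).le) (k := k) le_top
  change ‖iteratedFDeriv ℝ k (fun t : ℝ => ∑' n : ℤ, c n * fourier n (t : UnitAddCircle)) t‖ ≤ _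
  rw [h, ← tsum_mul_left]
  refine tsum_of_norm_bounded ((hc k).mul_left ((2 * Real.pi) ^ k)).hasSum fun n => ?_
  exact (norm_iteratedFDeriv_fourier_term (c n) n k t).le

end RapidDecay

theorem summable_mul_fourier {c : ℤ → ℂ} (hc : Summable fun n => ‖c n‖) (x : UnitAddCircle) :
    Summable fun n => c n * fourier n x :=
  Summable.of_norm (by simpa only [norm_mul, norm_fourier_apply, mul_one] using hc)

theorem continuous_synth {c : ℤ → ℂ} (hc : Summable fun n => ‖c n‖) : Continuous (synth c) :=
  continuous_tsum (fun n => continuous_const.mul (fourier n).continuous) hc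
    (fun n x => by rw [norm_mul, norm_fourier_apply, mul_one])

/-- Termwise integration of an absolutely convergent Fourier series against a continuous
function on the unit interval. -/
theorem integral_synth_mul {c : ℤ → ℂ} (hc : Summable fun n => ‖c n‖) {g : ℝ → ℂ}
    (hg : Continuous g) (hg1 : ∀ y, ‖g y‖ ≤ 1) :
    HasSum (fun n => c n * ∫ y in (0 : ℝ)..1, fourier n (y : UnitAddCircle) * g y)
      (∫ y in (0 : ℝ)..1, synth c (y : UnitAddCircle) * g y) := by
  have hco : ∀ n : ℤ, Continuous fun y : ℝ => fourier n (y : UnitAddCircle) := fun n =>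
    (fourier n).continuous.comp (AddCircle.continuous_mk' 1)
  have h := intervalIntegral.hasSum_integral_of_dominated_convergence (μ := MeasureTheory.volume)
    (a := (0 : ℝ)) (b := 1)
    (F := fun (n : ℤ) (y : ℝ) => c n * (fourier n (y : UnitAddCircle) * g y))
    (f := fun y => synth c (y : UnitAddCircle) * g y)
    (bound := fun n _ => ‖c n‖)
    (fun n => (continuous_const.mul ((hco n).mul hg)).aestronglyMeasurable)
    (fun n => Filter.Eventually.of_forall fun y _ => by
      rw [norm_mul, norm_mul, norm_fourier_apply, one_mul]
      exact mul_le_of_le_one_right (norm_nonneg _) (hg1 y))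
    (Filter.Eventually.of_forall fun y _ => hc)
    (by simp)
    (Filter.Eventually.of_forall fun y _ => by
      have := (summable_mul_fourier hc y).hasSum.mul_right (g y)
      simp only [mul_assoc] at this
      exact this)
  simpa only [intervalIntegral.integral_const_mul] using h

theorem fourierCoeff_eq_integral (f : UnitAddCircle → ℂ) (n : ℤ) :
    fourierCoeff f n = ∫ y in (0 : ℝ)..1, fourier (-n) (y : UnitAddCircle) * f y := by
  rw [fourierCoeff_eq_intervalIntegral f n 0]; simp

theorem integral_fourier (n : ℤ) :
    ∫ y in (0 : ℝ)..1, fourier n (y : UnitAddCircle) = if n = 0 then 1 else 0 := by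
  have h := fourierCoeff_eq_integral (fourier n) 0
  rw [fourierCoeff_fourier] at h
  simp only [neg_zero, fourier_zero, one_mul] at h
  rw [← h, Pi.single_apply]
  exact if_congr eq_comm rfl rfl

theorem fourierCoeff_synth {c : ℤ → ℂ} (hc : Summable fun n => ‖c n‖) (n : ℤ) :
    fourierCoeff (synth c) n = c n := by
  rw [fourierCoeff_eq_integral]
  have h := integral_synth_mul hc (g := fun y => fourier (-n) (y : UnitAddCircle))
    ((fourier (-n)).continuous.comp (AddCircle.continuous_mk' 1))
    (fun y => (norm_fourier_apply _ _).le)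
  simp_rw [← fourier_add, integral_fourier] at h
  have h2 := h.unique (hasSum_single n fun m hm => by
    rw [if_neg (by omega), mul_zero])
  rw [if_pos (by omega), mul_one] at h2
  rw [← h2]
  exact intervalIntegral.integral_congr fun y _ => mul_comm _ _

/-- Parseval's identity for continuous functions. -/
theorem hasSum_norm_sq_fourierCoeff {f : UnitAddCircle → ℂ} (hf : Continuous f) :
    HasSum (fun n => ‖fourierCoeff f n‖ ^ 2) (∫ y in (0 : ℝ)..1, ‖f y‖ ^ 2) := by
  have h := hasSum_sq_fourierCoeff
    (ContinuousMap.toLp (E := ℂ) 2 (AddCircle.haarAddCircle (T := (1 : ℝ))) ℂ ⟨f, hf⟩)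
  rw [fourierCoeff_congr_ae (ContinuousMap.coeFn_toLp _ _)] at h
  convert h using 1
  · rfl
  have h2 : ∫ t : UnitAddCircle, ‖ContinuousMap.toLp (E := ℂ) 2
      (AddCircle.haarAddCircle (T := (1 : ℝ))) ℂ ⟨f, hf⟩ t‖ ^ 2 ∂AddCircle.haarAddCircle
      = ∫ t : UnitAddCircle, ‖f t‖ ^ 2 ∂AddCircle.haarAddCircle := by
    refine MeasureTheory.integral_congr_ae ?_
    filter_upwards [ContinuousMap.coeFn_toLp (𝕜 := ℂ) (p := 2)
      (AddCircle.haarAddCircle (T := (1 : ℝ))) ⟨f, hf⟩] with x hx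
    rw [hx]; rfl
  rw [h2, AddCircle.integral_haarAddCircle, inv_one, one_smul,
    ← AddCircle.intervalIntegral_preimage 1 0 (fun t : UnitAddCircle => ‖f t‖ ^ 2), zero_add]

/-! ### The embedding of a weighted sequence space into the smooth functions -/

section Embedding

variable {a : ℤ → ℝ}

/-- Weights that grow faster than all powers. -/
structure IsRapidWeight (a : ℤ → ℝ) : Prop where
  pos : ∀ n, 0 < a n
  summable : ∀ k : ℕ, Summable fun n : ℤ => |(n : ℝ)| ^ k / a n

/-- The Fourier coefficients of the function represented by a sequence. -/
noncomputable def unweight (a : ℤ → ℝ) (h : SeqSpace) (n : ℤ) : ℂ := h n / a n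

theorem norm_unweight (ha : IsRapidWeight a) (h : SeqSpace) (n : ℤ) :
    ‖unweight a h n‖ = ‖h n‖ / a n := by
  rw [unweight, norm_div, Complex.norm_of_nonneg (ha.pos n).le]

theorem pow_mul_norm_unweight_le (ha : IsRapidWeight a) (h : SeqSpace) (k : ℕ) (n : ℤ) :
    |(n : ℝ)| ^ k * ‖unweight a h n‖ ≤ ‖h‖ * (|(n : ℝ)| ^ k / a n) := by
  have := ha.pos n
  rw [norm_unweight ha, mul_div_assoc', mul_div_assoc', mul_comm]
  gcongr
  exact h.norm_apply_le n

theorem rapidDecay_unweight (ha : IsRapidWeight a) (h : SeqSpace) : RapidDecay (unweight a h) :=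
  fun k => ((ha.summable k).mul_left ‖h‖).of_nonneg_of_le (fun n => by positivity)
    (pow_mul_norm_unweight_le ha h k)

/-- The embedding as a linear map. -/
noncomputable def embedₗ (ha : IsRapidWeight a) : SeqSpace →ₗ[ℂ] SmoothFun where
  toFun h := ⟨synth (unweight a h), (rapidDecay_unweight ha h).contDiff_synth⟩
  map_add' g h := by
    refine Subtype.ext (funext fun x => ?_)
    change synth _ x = synth _ x + synth _ x
    rw [synth, synth, synth, ← (summable_mul_fourier
      (rapidDecay_unweight ha g).summable_norm x).tsum_add
      (summable_mul_fourier (rapidDecay_unweight ha h).summable_norm x)]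
    refine tsum_congr fun n => ?_
    simp only [unweight, lp.coeFn_add, Pi.add_apply]
    ring
  map_smul' c h := by
    refine Subtype.ext (funext fun x => ?_)
    change synth _ x = c * synth _ x
    rw [synth, synth, ← tsum_mul_left]
    refine tsum_congr fun n => ?_
    simp only [unweight, lp.coeFn_smul, Pi.smul_apply, smul_eq_mul]
    ring

theorem continuous_embedₗ (ha : IsRapidWeight a) : Continuous (embedₗ ha) := by
  refine continuous_induced_rng.2 (continuous_pi fun k => ?_)
  rw [continuous_iff_continuousAt]
  intro h
  refine UniformFun.tendsto_iff_tendstoUniformly.2 (Metric.tendstoUniformly_iff.2 fun ε hε => ?_)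
  set C : ℝ := (2 * Real.pi) ^ k * ∑' n : ℤ, |(n : ℝ)| ^ k / a n with hC
  have hC0 : 0 ≤ C := by
    have := Real.pi_pos
    refine mul_nonneg (by positivity) (tsum_nonneg fun n => ?_)
    have := ha.pos n
    positivity
  have hev : ∀ᶠ g in nhds h, C * dist g h < ε := by
    have : Filter.Tendsto (fun g => C * dist g h) (nhds h) (nhds (C * dist h h)) :=
      (continuous_const.mul (continuous_id.dist continuous_const)).tendsto h
    rw [dist_self, mul_zero] at this
    exact this.eventually_lt_const hε
  filter_upwards [hev] with g hg t
  refine lt_of_le_of_lt ?_ hg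
  rw [dist_comm, dist_eq_norm, dist_eq_norm]
  change ‖iteratedDeriv k (fun t : ℝ => (embedₗ ha g : UnitAddCircle → ℂ) t) t
    - iteratedDeriv k (fun t : ℝ => (embedₗ ha h : UnitAddCircle → ℂ) t) t‖ ≤ _
  have hgs : ContDiffAt ℝ k (fun t : ℝ => (embedₗ ha g : UnitAddCircle → ℂ) t) t :=
    ((rapidDecay_unweight ha g).contDiff_synth.of_le (by exact_mod_cast le_top)).contDiffAt
  have hhs : ContDiffAt ℝ k (fun t : ℝ => (embedₗ ha h : UnitAddCircle → ℂ) t) t :=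
    ((rapidDecay_unweight ha h).contDiff_synth.of_le (by exact_mod_cast le_top)).contDiffAt
  rw [← iteratedDeriv_fun_sub hgs hhs]
  have hsub : (fun t : ℝ => (embedₗ ha g : UnitAddCircle → ℂ) t
      - (embedₗ ha h : UnitAddCircle → ℂ) t)
      = fun t : ℝ => synth (unweight a (g - h)) (t : UnitAddCircle) := by
    ext t
    exact (congrFun (congrArg Subtype.val (map_sub (embedₗ ha) g h)) (t : UnitAddCircle)).symm
  rw [hsub]
  refine ((rapidDecay_unweight ha (g - h)).norm_iteratedDeriv_synth_le k t).trans ?_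
  have := Real.pi_pos
  rw [hC, mul_assoc, mul_comm _ ‖g - h‖, ← tsum_mul_left (a := ‖g - h‖)]
  refine mul_le_mul_of_nonneg_left ?_ (by positivity)
  exact ((rapidDecay_unweight ha (g - h) k).tsum_le_tsum
    (pow_mul_norm_unweight_le ha _ k) ((ha.summable k).mul_left _))

/-- The embedding of the weighted sequence space into the smooth functions. -/
noncomputable def embed (ha : IsRapidWeight a) : SeqSpace →L[ℂ] SmoothFun :=
  ⟨embedₗ ha, continuous_embedₗ ha⟩

theorem coe_embed (ha : IsRapidWeight a) (h : SeqSpace) :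
    (embed ha h : UnitAddCircle → ℂ) = synth (unweight a h) := rfl

theorem fourierCoeff_embed (ha : IsRapidWeight a) (h : SeqSpace) (n : ℤ) :
    fourierCoeff (embed ha h : UnitAddCircle → ℂ) n = unweight a h n :=
  fourierCoeff_synth (rapidDecay_unweight ha h).summable_norm n

theorem injective_embed (ha : IsRapidWeight a) : Function.Injective (embed ha) := by
  intro g h hgh
  ext n
  have h1 := fourierCoeff_embed ha g n
  rw [hgh, fourierCoeff_embed, unweight, unweight] at h1
  have := ha.pos n
  have h2 : (a n : ℂ) ≠ 0 := by exact_mod_cast this.ne'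
  field_simp at h1
  exact h1.symm

theorem embed_single (ha : IsRapidWeight a) (n : ℤ) (z : ℂ) :
    (embed ha (lp.single 2 n z) : UnitAddCircle → ℂ) = (z / a n) • (fourier n) := by
  ext x
  rw [coe_embed, synth, tsum_eq_single n]
  · simp [unweight]
  · intro m hm
    simp [unweight, hm]

theorem exists_embed_eq (ha : IsRapidWeight a) {p : UnitAddCircle → ℂ}
    (hp : p ∈ trigPolynomials) : ∃ h, (embed ha h : UnitAddCircle → ℂ) = p := by
  induction hp using Submodule.span_induction with
  | mem p hp =>
    obtain ⟨n, rfl⟩ := hp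
    refine ⟨lp.single 2 n (a n : ℂ), ?_⟩
    have h2 : (a n : ℂ) ≠ 0 := by exact_mod_cast (ha.pos n).ne'
    rw [embed_single, div_self h2, one_smul]
  | zero => exact ⟨0, by rw [map_zero]; rfl⟩
  | add p q _ _ hp hq =>
    obtain ⟨g, rfl⟩ := hp
    obtain ⟨h, rfl⟩ := hq
    exact ⟨g + h, by rw [map_add]; rfl⟩
  | smul c p _ hp =>
    obtain ⟨h, rfl⟩ := hp
    exact ⟨c • h, by rw [map_smul]; rfl⟩

theorem dense_embed_trigPolynomials (ha : IsRapidWeight a) :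
    Dense {h : SeqSpace | (embed ha h : UnitAddCircle → ℂ) ∈ trigPolynomials} := by
  intro h
  refine mem_closure_of_tendsto (lp.hasSum_single (p := 2) (by norm_num) h)
    (Filter.Eventually.of_forall fun s => ?_)
  rw [Set.mem_ofPred_eq]
  induction s using Finset.induction_on with
  | empty => rw [Finset.sum_empty, map_zero]; exact Submodule.zero_mem _
  | insert n s hn ih =>
    rw [Finset.sum_insert hn, map_add]
    refine Submodule.add_mem _ ?_ ih
    rw [embed_single]
    exact Submodule.smul_mem _ _ (Submodule.subset_span ⟨n, rfl⟩)

end Embedding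

/-! ### Non-stationary phase in Denjoy–Carleman classes -/

theorem mul_le_of_logConvex {M : ℕ → ℝ} (hpos : ∀ k, 0 < M k) (h0 : M 0 = 1)
    (hconv : ∀ k, 1 ≤ k → M k ^ 2 ≤ M (k - 1) * M (k + 1)) (i k : ℕ) : M i * M k ≤ M (i + k) := by
  have hratio : Monotone fun k => M (k + 1) / M k := by
    refine monotone_nat_of_le_succ fun k => ?_
    rw [div_le_div_iff₀ (hpos _) (hpos _), ← sq, mul_comm]
    simpa using hconv (k + 1) (by omega)
  induction i with
  | zero => rw [h0, one_mul, zero_add]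
  | succ i ih =>
    have h1 := hratio (Nat.le_add_right i k)
    have hi := hpos i
    have hik := hpos (i + k)
    have h2 := hpos (i + 1)
    calc M (i + 1) * M k = M (i + 1) / M i * (M i * M k) := by field_simp
      _ ≤ M (i + k + 1) / M (i + k) * M (i + k) := by
          exact mul_le_mul h1 ih (mul_pos hi (hpos k)).le (div_pos (hpos _) hik).le
      _ = M (i + 1 + k) := by rw [div_mul_cancel₀ _ hik.ne', add_right_comm]

section Bounds

variable {M : ℕ → ℝ}

theorem norm_iteratedDeriv_inv_le (hM : IsWeightSeq M) (hmul : ∀ i k, M i * M k ≤ M (i + k))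
    {q : ℝ → ℂ} (hq : ContDiff ℝ ∞ q) {δ C R : ℝ} (hδ : 0 < δ) (hC : 0 < C) (hR : 0 < R)
    (hlow : ∀ t, δ ≤ ‖q t‖)
    (hup : ∀ i, 1 ≤ i → ∀ t, ‖iteratedDeriv i q t‖ ≤ C * R ^ i * i.factorial * M i)
    (j : ℕ) (t : ℝ) :
    ‖iteratedDeriv j (fun t => (q t)⁻¹) t‖
      ≤ δ⁻¹ * (R * (1 + C / δ)) ^ j * j.factorial * M j := by
  have hq0 : ∀ t, q t ≠ 0 := fun t h => by
    have := hlow t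
    rw [h, norm_zero] at this
    linarith
  have hg : ContDiff ℝ ∞ fun t => (q t)⁻¹ := hq.inv hq0
  set ρ : ℝ := R * (1 + C / δ) with hρ
  have hρ0 : 0 < ρ := by positivity
  induction j using Nat.strong_induction_on with
  | _ j ih =>
  rcases j with _ | j
  · simp only [iteratedDeriv_zero, norm_inv, pow_zero, Nat.factorial_zero, Nat.cast_one, mul_one,
      hM.zero]
    exact inv_anti₀ hδ (hlow t)
  · have hle : ∀ n : ℕ, ((n : ℕ∞) : WithTop ℕ∞) ≤ ((⊤ : ℕ∞) : WithTop ℕ∞) := fun n => by exact_mod_cast le_top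
    have h1 := iteratedDeriv_fun_mul (n := j + 1) (x := t) (hq.of_le (hle _)).contDiffAt
      (hg.of_le (hle _)).contDiffAt
    have h2 : (fun t => q t * (q t)⁻¹) = fun _ => (1 : ℂ) := by
      ext t; exact mul_inv_cancel₀ (hq0 t)
    rw [h2, iteratedDeriv_const, if_neg (Nat.succ_ne_zero j), Finset.sum_range_succ'] at h1
    simp only [Nat.choose_zero_right, Nat.cast_one, one_mul, iteratedDeriv_zero, tsub_zero,
      Nat.add_sub_add_right] at h1
    have h3 : q t * iteratedDeriv (j + 1) (fun t => (q t)⁻¹) t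
        = -∑ i ∈ Finset.range (j + 1), ((j + 1).choose (i + 1) : ℂ) * iteratedDeriv (i + 1) q t
          * iteratedDeriv (j - i) (fun t => (q t)⁻¹) t := by
      linear_combination -h1
    have h4 : ‖∑ i ∈ Finset.range (j + 1), ((j + 1).choose (i + 1) : ℂ)
          * iteratedDeriv (i + 1) q t * iteratedDeriv (j - i) (fun t => (q t)⁻¹) t‖
        ≤ ∑ i ∈ Finset.range (j + 1), C * δ⁻¹ * R * ((j + 1).factorial * M (j + 1))
          * (R ^ i * ρ ^ (j - i)) := by
      refine norm_sum_le_of_le _ fun i hi => ?_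
      have hij : i ≤ j := Nat.lt_succ_iff.1 (Finset.mem_range.1 hi)
      rw [norm_mul, norm_mul, Complex.norm_natCast]
      have hch := Nat.choose_mul_factorial_mul_factorial (Nat.succ_le_succ hij)
      simp only [Nat.succ_eq_add_one, Nat.add_sub_add_right] at hch
      have hch' : ((j + 1).choose (i + 1) : ℝ) * (i + 1).factorial * (j - i).factorial
          = (j + 1).factorial := by exact_mod_cast hch
      have hm := hmul (i + 1) (j - i)
      rw [show i + 1 + (j - i) = j + 1 by omega] at hm
      have hb1 := hup (i + 1) (by omega) t
      have hb2 := ih (j - i) (by omega)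
      have hp1 := hM.pos (i + 1)
      have hp2 := hM.pos (j - i)
      calc ((j + 1).choose (i + 1) : ℝ) * ‖iteratedDeriv (i + 1) q t‖
            * ‖iteratedDeriv (j - i) (fun t => (q t)⁻¹) t‖
          ≤ ((j + 1).choose (i + 1) : ℝ) * (C * R ^ (i + 1) * (i + 1).factorial * M (i + 1))
            * (δ⁻¹ * ρ ^ (j - i) * (j - i).factorial * M (j - i)) := by gcongr
        _ = C * δ⁻¹ * R * ((((j + 1).choose (i + 1) : ℝ) * (i + 1).factorial
            * (j - i).factorial) * (M (i + 1) * M (j - i))) * (R ^ i * ρ ^ (j - i)) := by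
            rw [pow_succ]; ring
        _ ≤ _ := by rw [hch']; gcongr
    have hgeom : (∑ i ∈ Finset.range (j + 1), R ^ i * ρ ^ (j - i)) * (R * (C / δ))
        ≤ ρ ^ (j + 1) := by
      have h := geom_sum₂_mul R ρ (j + 1)
      simp only [Nat.add_sub_cancel] at h
      have hRj : 0 < R ^ (j + 1) := by positivity
      have : R * (C / δ) = -(R - ρ) := by rw [hρ]; ring
      rw [this, mul_neg, h]
      linarith
    have h5 : δ * ‖iteratedDeriv (j + 1) (fun t => (q t)⁻¹) t‖
        ≤ ρ ^ (j + 1) * ((j + 1).factorial * M (j + 1)) := by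
      calc δ * ‖iteratedDeriv (j + 1) (fun t => (q t)⁻¹) t‖
          ≤ ‖q t * iteratedDeriv (j + 1) (fun t => (q t)⁻¹) t‖ := by
            rw [norm_mul]; gcongr; exact hlow t
        _ ≤ ∑ i ∈ Finset.range (j + 1), C * δ⁻¹ * R * ((j + 1).factorial * M (j + 1))
            * (R ^ i * ρ ^ (j - i)) := by rw [h3, norm_neg]; exact h4
        _ = ((∑ i ∈ Finset.range (j + 1), R ^ i * ρ ^ (j - i)) * (R * (C / δ)))
            * ((j + 1).factorial * M (j + 1)) := by
            rw [← Finset.mul_sum]; field_simp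
        _ ≤ _ := by
            have := hM.pos (j + 1)
            gcongr
    rw [mul_assoc, mul_assoc, ← div_eq_inv_mul, le_div_iff₀' hδ]
    exact h5

/-- The amplitudes produced by repeated integration by parts: `f ↦ (g f)'`, from `f = 1`. -/
noncomputable def ibpIter (g : ℝ → ℂ) : ℕ → ℝ → ℂ
  | 0 => fun _ => 1
  | k + 1 => deriv fun t => g t * ibpIter g k t

theorem contDiff_ibpIter {g : ℝ → ℂ} (hg : ContDiff ℝ ∞ g) (k : ℕ) :
    ContDiff ℝ ∞ (ibpIter g k) := by
  induction k with
  | zero => exact contDiff_const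
  | succ k ih => exact (contDiff_infty_iff_deriv.1 (hg.mul ih)).2

theorem periodic_ibpIter {g : ℝ → ℂ} {c : ℝ} (hg : Function.Periodic g c) (k : ℕ) :
    Function.Periodic (ibpIter g k) c := by
  induction k with
  | zero => exact fun _ => rfl
  | succ k ih =>
    intro t
    change deriv (fun t => g t * ibpIter g k t) (t + c) = deriv (fun t => g t * ibpIter g k t) t
    rw [← deriv_comp_add_const]
    congr 1
    ext s
    rw [hg, ih]

theorem norm_iteratedDeriv_ibpIter_le (hM : IsWeightSeq M)
    (hmul : ∀ i k, M i * M k ≤ M (i + k)) {g : ℝ → ℂ} (hg : ContDiff ℝ ∞ g) {c ρ : ℝ}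
    (hc : 0 < c) (hρ : 0 < ρ)
    (hup : ∀ j t, ‖iteratedDeriv j g t‖ ≤ c * ρ ^ j * j.factorial * M j) (k j : ℕ) (t : ℝ) :
    ‖iteratedDeriv j (ibpIter g k) t‖
      ≤ (4 * c * ρ) ^ k * (2 * ρ) ^ j * (k + j).factorial * M (k + j) := by
  have hle : ∀ n : ℕ, ((n : ℕ∞) : WithTop ℕ∞) ≤ ((⊤ : ℕ∞) : WithTop ℕ∞) := fun n => by exact_mod_cast le_top
  induction k generalizing j t with
  | zero =>
    have := hM.pos (0 + j)
    rcases j with _ | j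
    · simp [ibpIter, hM.zero]
    · change ‖iteratedDeriv (j + 1) (fun _ => (1 : ℂ)) t‖ ≤ _
      rw [iteratedDeriv_const, if_neg (Nat.succ_ne_zero j), norm_zero]
      positivity
  | succ k ih =>
    change ‖iteratedDeriv j (deriv fun t => g t * ibpIter g k t) t‖ ≤ _
    rw [← iteratedDeriv_succ', iteratedDeriv_fun_mul (hg.of_le (hle _)).contDiffAt
      ((contDiff_ibpIter hg k).of_le (hle _)).contDiffAt]
    have hMp := hM.pos (k + 1 + j)
    have hterm : ∀ i ∈ Finset.range (j + 1 + 1),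
        ‖((j + 1).choose i : ℂ) * iteratedDeriv i g t
          * iteratedDeriv (j + 1 - i) (ibpIter g k) t‖
        ≤ (4 * c * ρ) ^ k * c * (2 * ρ) ^ (j + 1) * ((k + 1 + j).factorial * M (k + 1 + j))
          * (1 / 2) ^ i := by
      intro i hi
      have hij : i ≤ j + 1 := Nat.lt_succ_iff.1 (Finset.mem_range.1 hi)
      obtain ⟨l, hl⟩ := Nat.exists_eq_add_of_le hij
      have hl' : j + 1 - i = l := by omega
      rw [hl', norm_mul, norm_mul, Complex.norm_natCast]
      have hfac : (j + 1).choose i * i.factorial * (k + l).factorial ≤ (k + 1 + j).factorial := by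
        have h1 : (j + 1).choose i ≤ (k + 1 + j).choose i := Nat.choose_le_choose i (by omega)
        have h2 := Nat.choose_mul_factorial_mul_factorial (n := k + 1 + j) (k := i) (by omega)
        rw [show k + 1 + j - i = k + l by omega] at h2
        rw [← h2]
        gcongr
      have hfac' : ((j + 1).choose i : ℝ) * i.factorial * (k + l).factorial
          ≤ (k + 1 + j).factorial := by exact_mod_cast hfac
      have hm := hmul i (k + l)
      rw [show i + (k + l) = k + 1 + j by omega] at hm
      have hb1 := hup i t
      have hb2 := ih l t
      have hp1 := hM.pos i
      have hp2 := hM.pos (k + l)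
      calc ((j + 1).choose i : ℝ) * ‖iteratedDeriv i g t‖ * ‖iteratedDeriv l (ibpIter g k) t‖
          ≤ ((j + 1).choose i : ℝ) * (c * ρ ^ i * i.factorial * M i)
            * ((4 * c * ρ) ^ k * (2 * ρ) ^ l * (k + l).factorial * M (k + l)) := by gcongr
        _ = (4 * c * ρ) ^ k * c * (ρ ^ i * (2 * ρ) ^ l)
            * ((((j + 1).choose i : ℝ) * i.factorial * (k + l).factorial)
              * (M i * M (k + l))) := by ring
        _ ≤ (4 * c * ρ) ^ k * c * (ρ ^ i * (2 * ρ) ^ l)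
            * ((k + 1 + j).factorial * M (k + 1 + j)) := by gcongr
        _ = _ := by
            rw [hl, pow_add (2 * ρ), mul_pow 2 ρ i, one_div, inv_pow]
            field_simp
    refine (norm_sum_le_of_le _ hterm).trans ?_
    rw [← Finset.mul_sum]
    have hgeo : ∑ i ∈ Finset.range (j + 1 + 1), (1 / 2 : ℝ) ^ i ≤ 2 := by
      refine le_of_le_of_eq ?_ tsum_geometric_two
      exact summable_geometric_two.sum_le_tsum _ (fun i _ => by positivity)
    calc _ ≤ (4 * c * ρ) ^ k * c * (2 * ρ) ^ (j + 1)
            * ((k + 1 + j).factorial * M (k + 1 + j)) * 2 := by gcongr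
      _ = _ := by rw [pow_succ (4 * c * ρ), pow_succ (2 * ρ)]; ring

end Bounds

/-- Repeated integration by parts. -/
theorem integral_eq_integral_ibpIter {q E : ℝ → ℂ} (hq : ContDiff ℝ ∞ q) (hq0 : ∀ t, q t ≠ 0)
    (hqp : Function.Periodic q 1) {c : ℂ} (hc : c ≠ 0)
    (hE : ∀ t, HasDerivAt E (-c * q t * E t) t) (hE1 : E 1 = E 0) (k : ℕ) :
    ∫ t in (0 : ℝ)..1, E t = (c⁻¹) ^ k * ∫ t in (0 : ℝ)..1, ibpIter (fun t => (q t)⁻¹) k t * E t := by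
  have hg : ContDiff ℝ ∞ fun t => (q t)⁻¹ := hq.inv hq0
  have hEc : Continuous E := continuous_iff_continuousAt.2 fun t => (hE t).continuousAt
  induction k with
  | zero => simp [ibpIter]
  | succ k ih =>
    rw [ih, pow_succ, mul_assoc]
    congr 1
    set f := ibpIter (fun t => (q t)⁻¹) k with hf
    have hfs : ContDiff ℝ ∞ f := contDiff_ibpIter hg k
    have hu : ContDiff ℝ ∞ fun t => (q t)⁻¹ * f t := hg.mul hfs
    have hper : (q 1)⁻¹ * f 1 = (q 0)⁻¹ * f 0 := by
      have h1 := hqp 0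
      have h2 : f (0 + 1) = f 0 :=
        periodic_ibpIter (g := fun t => (q t)⁻¹) (fun t => by simp only [hqp t]) k 0
      rw [zero_add] at h1 h2
      rw [h1, h2]
    have hud : ∀ t, HasDerivAt (fun t => (q t)⁻¹ * f t) (deriv (fun t => (q t)⁻¹ * f t) t) t :=
      fun t => (hu.differentiable (by simp) t).hasDerivAt
    have hparts := intervalIntegral.integral_mul_deriv_eq_deriv_mul (a := (0 : ℝ)) (b := 1)
      (u := fun t => (q t)⁻¹ * f t) (v := E) (fun t _ => hud t) (fun t _ => hE t)
      ((hu.continuous_deriv (by simp)).intervalIntegrable _ _)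
      (((continuous_const.mul hq.continuous).mul hEc).intervalIntegrable _ _)
    rw [hper, hE1, sub_self, zero_sub] at hparts
    have hlhs : ∫ t in (0 : ℝ)..1, (q t)⁻¹ * f t * (-c * q t * E t)
        = -c * ∫ t in (0 : ℝ)..1, f t * E t := by
      rw [← intervalIntegral.integral_const_mul]
      refine intervalIntegral.integral_congr fun t _ => ?_
      have := hq0 t
      field_simp
    rw [hlhs] at hparts
    have : c * ∫ t in (0 : ℝ)..1, f t * E t
        = ∫ t in (0 : ℝ)..1, deriv (fun t => (q t)⁻¹ * f t) t * E t := by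
      linear_combination -hparts
    change _ = c⁻¹ * ∫ t in (0 : ℝ)..1, deriv (fun t => (q t)⁻¹ * f t) t * E t
    rw [← this, inv_mul_cancel_left₀ hc]

/-! ### Lifts of expanding circle maps -/

theorem coe_unit_eq_coe_iff (a b : ℝ) : (a : UnitAddCircle) = b ↔ ∃ n : ℤ, a = b + n := by
  rw [← sub_eq_zero, ← AddCircle.coe_sub, AddCircle.coe_eq_zero_iff]
  constructor
  · rintro ⟨n, hn⟩
    exact ⟨n, by rw [zsmul_eq_mul, mul_one] at hn; linarith⟩
  · rintro ⟨n, hn⟩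
    exact ⟨n, by rw [zsmul_eq_mul, mul_one]; linarith⟩

theorem coe_unit_add_intCast (a : ℝ) (n : ℤ) : ((a + n : ℝ) : UnitAddCircle) = a :=
  (coe_unit_eq_coe_iff _ _).2 ⟨n, rfl⟩

/-- A smooth lift of degree `d` of an expanding circle map. -/
structure IsExpandingLift (F : ℝ → ℝ) (d : ℤ) (lam : ℝ) : Prop where
  contDiff : ContDiff ℝ ∞ F
  add_one : ∀ t, F (t + 1) = F t + d
  one_lt : 1 < lam
  expand : ∀ t, lam ≤ |deriv F t|

theorem exists_degree {T : UnitAddCircle → UnitAddCircle} {F : ℝ → ℝ} (hF : IsSmoothLift T F) :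
    ∃ d : ℤ, ∀ t, F (t + 1) = F t + d := by
  have h : ∀ t, ∃ n : ℤ, F (t + 1) = F t + n := fun t => by
    rw [← coe_unit_eq_coe_iff, ← hF.2, ← hF.2]
    congr 1
    exact_mod_cast coe_unit_add_intCast t 1
  choose n hn using h
  have hn' : (fun t => ((n t : ℤ) : ℝ)) = fun t => F (t + 1) - F t := by
    ext t; rw [hn t]; ring
  have hc : Continuous fun t => ((n t : ℤ) : ℝ) := by
    rw [hn']
    exact (hF.1.continuous.comp (continuous_id.add continuous_const)).sub hF.1.continuous
  have hc' : Continuous n := Int.isClosedEmbedding_coe_real.isEmbedding.continuous_iff.2 hc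
  exact ⟨n 0, fun t => by rw [hn t, PreconnectedSpace.constant inferInstance hc' (x := t) (y := 0)]⟩

namespace IsExpandingLift

variable {F : ℝ → ℝ} {d : ℤ} {lam : ℝ}

theorem hasDerivAt (h : IsExpandingLift F d lam) (t : ℝ) : HasDerivAt F (deriv F t) t :=
  (h.contDiff.differentiable (by simp) t).hasDerivAt

theorem continuous_deriv (h : IsExpandingLift F d lam) : Continuous (deriv F) :=
  h.contDiff.continuous_deriv (by simp)

theorem abs_deriv_pos (h : IsExpandingLift F d lam) (t : ℝ) : 0 < |deriv F t| :=
  (one_pos.trans h.one_lt).trans_le (h.expand t)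

theorem periodic_deriv (h : IsExpandingLift F d lam) : Function.Periodic (deriv F) 1 := by
  intro t
  rw [← deriv_comp_add_const]
  have : (fun t => F (t + 1)) = fun t => F t + d := funext h.add_one
  rw [this, deriv_add_const]

theorem add_intCast (h : IsExpandingLift F d lam) (t : ℝ) (k : ℤ) : F (t + k) = F t + k * d := by
  have hp : Function.Periodic (fun t => F t - t * d) 1 := fun t => by
    simp only [h.add_one]; ring
  have := hp.int_mul k t
  simp only [mul_one] at this
  linarith

theorem mul_abs_sub_le (h : IsExpandingLift F d lam) (a b : ℝ) :
    lam * |a - b| ≤ |F a - F b| := by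
  have key : ∀ a b, a < b → lam * |a - b| ≤ |F a - F b| := by
    intro a b hab
    obtain ⟨c, _, hc⟩ := exists_hasDerivAt_eq_slope F (deriv F) hab
      h.contDiff.continuous.continuousOn (fun x _ => h.hasDerivAt x)
    have h1 := h.expand c
    rw [hc, abs_div, le_div_iff₀ (abs_pos.2 (sub_ne_zero.2 hab.ne'))] at h1
    rwa [abs_sub_comm a, abs_sub_comm (F a)]
  rcases lt_trichotomy a b with hab | rfl | hab
  · exact key a b hab
  · simp
  · rw [abs_sub_comm a, abs_sub_comm (F a)]
    exact key b a hab

theorem injective (h : IsExpandingLift F d lam) : Function.Injective F := by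
  intro a b hab
  have h1 := h.mul_abs_sub_le a b
  rw [hab, sub_self, abs_zero] at h1
  have h2 := h.one_lt
  have h3 : |a - b| ≤ 0 := by nlinarith [abs_nonneg (a - b)]
  exact sub_eq_zero.1 (abs_nonpos_iff.1 h3)

theorem degree_ne_zero (h : IsExpandingLift F d lam) : d ≠ 0 := by
  rintro rfl
  have h1 := h.add_one 0
  rw [Int.cast_zero, add_zero] at h1
  have := h.injective h1
  norm_num at this

theorem surjective (h : IsExpandingLift F d lam) : Function.Surjective F := by
  intro y
  have hd : (d : ℝ) * d ≥ 1 := by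
    have : 0 < d * d := mul_self_pos.2 h.degree_ne_zero
    exact_mod_cast this
  obtain ⟨k, hk⟩ := exists_nat_ge |y - F 0|
  have hk' := abs_le.1 hk
  refine mem_range_of_exists_le_of_exists_ge h.contDiff.continuous ⟨0 + ((-k * d : ℤ) : ℝ), ?_⟩
    ⟨0 + ((k * d : ℤ) : ℝ), ?_⟩
  · rw [h.add_intCast]
    push_cast
    nlinarith [(Nat.cast_nonneg k : (0 : ℝ) ≤ k)]
  · rw [h.add_intCast]
    push_cast
    nlinarith [(Nat.cast_nonneg k : (0 : ℝ) ≤ k)]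

/-- The inverse of a lift. -/
noncomputable def inverse (h : IsExpandingLift F d lam) : ℝ → ℝ :=
  (Equiv.ofBijective F ⟨h.injective, h.surjective⟩).symm

theorem apply_inverse (h : IsExpandingLift F d lam) (x : ℝ) : F (h.inverse x) = x :=
  (Equiv.ofBijective F ⟨h.injective, h.surjective⟩).apply_symm_apply x

theorem inverse_apply (h : IsExpandingLift F d lam) (x : ℝ) : h.inverse (F x) = x :=
  (Equiv.ofBijective F ⟨h.injective, h.surjective⟩).symm_apply_apply x

theorem continuous_inverse (h : IsExpandingLift F d lam) : Continuous h.inverse := by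
  refine (LipschitzWith.of_dist_le_mul (K := 1) fun x y => ?_).continuous
  have h1 := h.mul_abs_sub_le (h.inverse x) (h.inverse y)
  rw [h.apply_inverse, h.apply_inverse] at h1
  rw [NNReal.coe_one, one_mul, Real.dist_eq, Real.dist_eq]
  nlinarith [abs_nonneg (h.inverse x - h.inverse y), h.one_lt]

theorem inverse_add_mul (h : IsExpandingLift F d lam) (x : ℝ) (k : ℤ) :
    h.inverse (x + k * d) = h.inverse x + k := by
  apply h.injective
  rw [h.apply_inverse, h.add_intCast, h.apply_inverse]

/-- The sign of the derivative is the sign of the degree. -/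
theorem deriv_sign (h : IsExpandingLift F d lam) :
    (0 < d ∧ ∀ t, |deriv F t| = deriv F t) ∨ (d < 0 ∧ ∀ t, |deriv F t| = -deriv F t) := by
  have hne : ∀ t, deriv F t ≠ 0 := fun t => abs_pos.1 (h.abs_deriv_pos t)
  have h1 := h.add_one 0
  rw [zero_add] at h1
  by_cases hpos : ∃ t, 0 < deriv F t
  · have hall : ∀ t, 0 < deriv F t := by
      intro t
      by_contra hcon
      obtain ⟨s, hs⟩ := mem_range_of_exists_le_of_exists_ge h.continuous_deriv
        ⟨t, not_lt.1 hcon⟩ (hpos.imp fun _ hs => hs.le)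
      exact hne s hs
    refine Or.inl ⟨?_, fun t => abs_of_pos (hall t)⟩
    have := strictMono_of_deriv_pos hall zero_lt_one
    have h2 : (0 : ℝ) < d := by linarith
    exact_mod_cast h2
  · have hall : ∀ t, deriv F t < 0 := fun t =>
      lt_of_le_of_ne (not_lt.1 fun ht => hpos ⟨t, ht⟩) (hne t)
    refine Or.inr ⟨?_, fun t => abs_of_neg (hall t)⟩
    have := strictAnti_of_deriv_neg hall zero_lt_one
    have h2 : (d : ℝ) < 0 := by linarith
    exact_mod_cast h2

section ChangeOfVariables

variable {E : Type*} [NormedAddCommGroup E] [NormedSpace ℝ E]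

/-- The sum over the inverse branches at `x`. -/
noncomputable def branchSum (h : IsExpandingLift F d lam) (H : ℝ → E) (x : ℝ) : E :=
  ∑ j ∈ Finset.range d.natAbs,
    |deriv F (h.inverse (x + j))|⁻¹ • H (h.inverse (x + j))

theorem continuous_branch (h : IsExpandingLift F d lam) {H : ℝ → E} (hH : Continuous H) :
    Continuous fun x => |deriv F (h.inverse x)|⁻¹ • H (h.inverse x) :=
  ((h.continuous_deriv.comp h.continuous_inverse).abs.inv₀
    fun _ => (h.abs_deriv_pos _).ne').smul (hH.comp h.continuous_inverse)

theorem continuous_branchSum (h : IsExpandingLift F d lam) {H : ℝ → E} (hH : Continuous H) :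
    Continuous (h.branchSum H) :=
  continuous_finsetSum _ fun _ _ =>
    (h.continuous_branch hH).comp (continuous_id.add continuous_const)

theorem integral_branchSum (h : IsExpandingLift F d lam) {H : ℝ → E} (hH : Continuous H)
    (hper : Function.Periodic H 1) :
    ∫ x in (0 : ℝ)..1, h.branchSum H x = ∫ y in (0 : ℝ)..1, H y := by
  set B : ℝ → E := fun x => |deriv F (h.inverse x)|⁻¹ • H (h.inverse x) with hB
  have hBc : Continuous B := h.continuous_branch hH
  have hBper : ∀ k : ℤ, Function.Periodic B (k * d) := fun k x => by
    simp only [hB, h.inverse_add_mul]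
    have h1 := h.periodic_deriv.int_mul k (h.inverse x)
    have h2 := hper.int_mul k (h.inverse x)
    rw [mul_one] at h1 h2
    rw [h1, h2]
  have hsum : ∫ x in (0 : ℝ)..1, h.branchSum H x = ∫ x in (0 : ℝ)..d.natAbs, B x := by
    have h1 : ∫ x in (0 : ℝ)..1, h.branchSum H x
        = ∑ j ∈ Finset.range d.natAbs, ∫ x in (0 : ℝ)..1, B (x + j) :=
      intervalIntegral.integral_finsetSum fun j _ =>
        (hBc.comp (continuous_id.add continuous_const)).intervalIntegrable _ _
    have h2 := intervalIntegral.sum_integral_adjacent_intervals (μ := MeasureTheory.volume)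
      (f := B) (a := fun j : ℕ => (j : ℝ)) (n := d.natAbs)
      (fun j _ => hBc.intervalIntegrable _ _)
    rw [h1, ← Nat.cast_zero (R := ℝ), ← h2]
    refine Finset.sum_congr rfl fun j _ => ?_
    rw [intervalIntegral.integral_comp_add_right]
    congr 1 <;> push_cast <;> ring
  have hcov := intervalIntegral.integral_deriv_smul_comp (a := (0 : ℝ)) (b := 1) (g := B)
    (fun t _ => h.hasDerivAt t) h.continuous_deriv.continuousOn hBc
  have h1 := h.add_one 0
  rw [zero_add] at h1
  rw [h1] at hcov
  simp only [Function.comp_apply, hB, h.inverse_apply] at hcov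
  rw [hsum]
  have hpos := h.abs_deriv_pos
  rcases h.deriv_sign with ⟨hd, hs⟩ | ⟨hd, hs⟩
  · have hD : ((d.natAbs : ℕ) : ℝ) = d := by
      rw [Nat.cast_natAbs, abs_of_pos hd]
    have e1 : ∫ x in (0 : ℝ)..1, deriv F x • |deriv F x|⁻¹ • H x = ∫ y in (0 : ℝ)..1, H y := by
      refine intervalIntegral.integral_congr fun t _ => ?_
      rw [← hs, abs_abs, smul_smul, mul_inv_cancel₀ (hpos t).ne', one_smul]
    have e2 := (hBper 1).intervalIntegral_add_eq 0 (F 0)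
    rw [Int.cast_one, one_mul, zero_add] at e2
    rw [hD, e2, ← e1, hcov]
  · have hD : ((d.natAbs : ℕ) : ℝ) = -d := by
      rw [Nat.cast_natAbs, abs_of_neg hd]; push_cast; rfl
    have e1 : ∫ x in (0 : ℝ)..1, deriv F x • |deriv F x|⁻¹ • H x
        = -∫ y in (0 : ℝ)..1, H y := by
      rw [← intervalIntegral.integral_neg]
      refine intervalIntegral.integral_congr fun t _ => ?_
      rw [← neg_neg (deriv F t), ← hs, smul_smul, neg_mul, abs_neg, abs_abs,
        mul_inv_cancel₀ (hpos t).ne', neg_smul, one_smul]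
    have e2 := (hBper (-1)).intervalIntegral_add_eq 0 (F 0 + d)
    push_cast at e2
    rw [neg_one_mul, zero_add, add_neg_cancel_right] at e2
    rw [hD, e2, intervalIntegral.integral_symm, ← hcov, e1, neg_neg]

end ChangeOfVariables

end IsExpandingLift

/-! ### The transfer operator -/

section Transfer

variable {T : UnitAddCircle → UnitAddCircle} {F : ℝ → ℝ} {d : ℤ} {lam : ℝ}

theorem transferOperator_coe (hF : IsSmoothLift T F) (h : IsExpandingLift F d lam)
    (φ : UnitAddCircle → ℂ) (x : ℝ) :
    transferOperator T φ x = h.branchSum (fun t : ℝ => φ t) x := by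
  have hbij : Set.BijOn (fun j : ℕ => (h.inverse (x + j) : UnitAddCircle))
      (Finset.range d.natAbs : Set ℕ) {y | T y = x} := by
    refine ⟨fun j _ => ?_, fun i hi j hj hij => ?_, fun y hy => ?_⟩
    · change T _ = _
      rw [hF.2, h.apply_inverse]
      exact_mod_cast coe_unit_add_intCast x j
    · obtain ⟨l, hl⟩ := (coe_unit_eq_coe_iff _ _).1 hij
      have h1 := congrArg F hl
      rw [h.apply_inverse, h.add_intCast, h.apply_inverse] at h1
      have h2 : (i : ℝ) = j + l * d := by linarith
      have h3 : (i : ℤ) = j + l * d := by exact_mod_cast h2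
      rw [Finset.mem_coe, Finset.mem_range] at hi hj
      have h4 : ((i : ℤ) - j).natAbs < d.natAbs := by omega
      have h5 : (i : ℤ) - j = 0 :=
        Int.eq_zero_of_dvd_of_natAbs_lt_natAbs ⟨l, by rw [h3]; ring⟩ h4
      omega
    · obtain ⟨s, rfl⟩ := QuotientAddGroup.mk_surjective y
      have hy' : T (s : UnitAddCircle) = x := hy
      rw [hF.2] at hy'
      obtain ⟨n, hn⟩ := (coe_unit_eq_coe_iff _ _).1 hy'
      have hr0 := Int.emod_nonneg n h.degree_ne_zero
      have hr1 := Int.emod_lt_abs n h.degree_ne_zero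
      rw [Int.abs_eq_natAbs] at hr1
      refine ⟨(n % d).toNat, ?_, ?_⟩
      · rw [Finset.mem_coe, Finset.mem_range]; omega
      · change ((h.inverse (x + (n % d).toNat) : ℝ) : UnitAddCircle) = (s : ℝ)
        rw [eq_comm, coe_unit_eq_coe_iff]
        refine ⟨n / d, ?_⟩
        rw [← h.inverse_add_mul, ← h.inverse_apply s, hn]
        congr 1
        have h1 : ((n % d).toNat : ℝ) = ((n % d : ℤ) : ℝ) := by
          exact_mod_cast Int.toNat_of_nonneg hr0
        have h2 : (n : ℝ) = (n % d : ℤ) + (n / d : ℤ) * d := by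
          exact_mod_cast (Int.emod_add_ediv_mul n d).symm
        rw [h1, h2]; ring
  rw [transferOperator, ← finsum_mem_eq_of_bijOn _ hbij (fun j _ => rfl),
    finsum_mem_coe_finset, IsExpandingLift.branchSum]
  refine Finset.sum_congr rfl fun j _ => ?_
  rw [circleDeriv_coe hF, one_div, Complex.real_smul]

theorem continuous_of_comp_coe {X : Type*} [TopologicalSpace X] {f : UnitAddCircle → X}
    (hf : Continuous fun t : ℝ => f t) : Continuous f :=
  QuotientAddGroup.isOpenQuotientMap_mk.isQuotientMap.continuous_iff.2 hf

theorem continuous_transferOperator (hF : IsSmoothLift T F) (h : IsExpandingLift F d lam)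
    {φ : UnitAddCircle → ℂ} (hφ : Continuous φ) : Continuous (transferOperator T φ) := by
  refine continuous_of_comp_coe ?_
  simp_rw [transferOperator_coe hF h]
  exact h.continuous_branchSum (hφ.comp (AddCircle.continuous_mk' 1))

theorem fourierCoeff_transferOperator (hF : IsSmoothLift T F) (h : IsExpandingLift F d lam)
    {φ : UnitAddCircle → ℂ} (hφ : Continuous φ) (n : ℤ) :
    fourierCoeff (transferOperator T φ) n
      = ∫ y in (0 : ℝ)..1, φ y * fourier (-n) (F y : UnitAddCircle) := by
  have hco : Continuous fun y : ℝ => (y : UnitAddCircle) := AddCircle.continuous_mk' 1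
  have hc : Continuous fun y : ℝ => φ y * fourier (-n) (F y : UnitAddCircle) :=
    (hφ.comp hco).mul ((fourier (-n)).continuous.comp (hco.comp h.contDiff.continuous))
  rw [fourierCoeff_eq_integral, ← h.integral_branchSum hc]
  · refine intervalIntegral.integral_congr fun x _ => ?_
    rw [transferOperator_coe hF h, IsExpandingLift.branchSum, IsExpandingLift.branchSum,
      Finset.mul_sum]
    refine Finset.sum_congr rfl fun j _ => ?_
    have : ((x + (j : ℝ) : ℝ) : UnitAddCircle) = x := by
      exact_mod_cast coe_unit_add_intCast x j
    rw [Complex.real_smul, Complex.real_smul, h.apply_inverse, this]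
    ring
  · intro t
    have h1 : ((t + 1 : ℝ) : UnitAddCircle) = t := by exact_mod_cast coe_unit_add_intCast t 1
    dsimp only
    rw [h.add_one, coe_unit_add_intCast, h1]

theorem tsum_norm_sq_fourierCoeff_transferOperator_le (hF : IsSmoothLift T F)
    (h : IsExpandingLift F d lam) {φ : UnitAddCircle → ℂ} (hφ : Continuous φ) :
    ∑' n, ‖fourierCoeff (transferOperator T φ) n‖ ^ 2
      ≤ d.natAbs * ∑' n, ‖fourierCoeff φ n‖ ^ 2 := by
  have hco : Continuous fun y : ℝ => (y : UnitAddCircle) := AddCircle.continuous_mk' 1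
  have hLφ := continuous_transferOperator hF h hφ
  rw [(hasSum_norm_sq_fourierCoeff hLφ).tsum_eq, (hasSum_norm_sq_fourierCoeff hφ).tsum_eq]
  have hHc : Continuous fun y : ℝ => ‖φ y‖ ^ 2 := (hφ.comp hco).norm.pow 2
  rw [← h.integral_branchSum hHc (fun t => by
    have h1 : ((t + 1 : ℝ) : UnitAddCircle) = t := by exact_mod_cast coe_unit_add_intCast t 1
    simp only [h1]), ← intervalIntegral.integral_const_mul]
  refine intervalIntegral.integral_mono_on zero_le_one
    (((hLφ.comp hco).norm.pow 2).intervalIntegrable _ _)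
    ((continuous_const.mul (h.continuous_branchSum hHc)).intervalIntegrable _ _) fun x _ => ?_
  rw [transferOperator_coe hF h, IsExpandingLift.branchSum, IsExpandingLift.branchSum]
  refine (pow_le_pow_left₀ (norm_nonneg _) (norm_sum_le _ _) 2).trans
    (sq_sum_le_card_mul_sum_sq.trans ?_)
  rw [Finset.card_range]
  gcongr with j hj
  have hp := h.abs_deriv_pos (h.inverse (x + j))
  have hle : |deriv F (h.inverse (x + j))|⁻¹ ≤ 1 :=
    inv_le_one_of_one_le₀ (h.one_lt.le.trans (h.expand _))
  rw [norm_smul, norm_inv, Real.norm_eq_abs, abs_abs, mul_pow, smul_eq_mul, sq |_|⁻¹, mul_assoc]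
  exact mul_le_of_le_one_left (by positivity) hle

end Transfer

/-! ### The matrix of the transfer operator in the Fourier basis -/

/-- The `(n, m)` entry of the matrix of the transfer operator. -/
noncomputable def kernel (F : ℝ → ℝ) (n m : ℤ) : ℂ :=
  ∫ y in (0 : ℝ)..1, fourier m (y : UnitAddCircle) * fourier (-n) (F y : UnitAddCircle)

theorem norm_kernel_le_one (F : ℝ → ℝ) (n m : ℤ) : ‖kernel F n m‖ ≤ 1 := by
  have h := intervalIntegral.norm_integral_le_of_norm_le_const (a := (0 : ℝ)) (b := 1) (C := 1)
    (f := fun y => fourier m (y : UnitAddCircle) * fourier (-n) (F y : UnitAddCircle))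
    (fun y _ => by rw [norm_mul, norm_fourier_apply, norm_fourier_apply, one_mul])
  rwa [sub_zero, abs_one, mul_one] at h

section Kernel

variable {T : UnitAddCircle → UnitAddCircle} {F : ℝ → ℝ} {d : ℤ} {lam : ℝ}

theorem hasSum_fourierCoeff_transferOperator_synth (hF : IsSmoothLift T F)
    (h : IsExpandingLift F d lam) {f : ℤ → ℂ} (hf : Summable fun m => ‖f m‖) (n : ℤ) :
    HasSum (fun m => f m * kernel F n m) (fourierCoeff (transferOperator T (synth f)) n) := by
  rw [fourierCoeff_transferOperator hF h (continuous_synth hf)]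
  exact integral_synth_mul hf
    ((fourier (-n)).continuous.comp ((AddCircle.continuous_mk' 1).comp h.contDiff.continuous))
    (fun y => (norm_fourier_apply _ _).le)

theorem kernel_eq (n m : ℤ) : kernel F n m
    = ∫ y in (0 : ℝ)..1, Complex.exp (2 * Real.pi * Complex.I * (m * y - n * F y)) := by
  refine intervalIntegral.integral_congr fun y _ => ?_
  rw [fourier_unit_apply, fourier_unit_apply, ← Complex.exp_add]
  congr 1
  push_cast
  ring

/-- Non-stationary phase: the entries below the cone `|m| > θ |n|` are small. -/
theorem exists_norm_kernel_le {M : ℕ → ℝ} (hM : IsWeightSeq M)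
    (hmul : ∀ i k, M i * M k ≤ M (i + k)) (hF : IsSmoothLift T F) (h : IsExpandingLift F d lam)
    (hT : DenjoyCarleman M (fun x => (circleDeriv T x : ℂ))) {θ : ℝ} (hθ : θ < lam) :
    ∃ A₀ : ℝ, 0 < A₀ ∧ ∀ n m : ℤ, n ≠ 0 → |(m : ℝ)| ≤ θ * |(n : ℝ)| →
      ‖kernel F n m‖ ≤ weight M (A₀ / |(n : ℝ)|) := by
  obtain ⟨hs, C, R, hC, hR, hbound⟩ := hT
  simp_rw [circleDeriv_coe hF] at hbound
  set δ : ℝ := lam - θ with hδ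
  have hδ0 : 0 < δ := sub_pos.2 hθ
  set ρ : ℝ := R * (1 + C / δ) with hρ
  have hρ0 : 0 < ρ := by positivity
  have hpi := Real.pi_pos
  refine ⟨4 * δ⁻¹ * ρ / (2 * Real.pi), by positivity, fun n m hn hmn => le_ciInf fun k => ?_⟩
  have hn' : 0 < |(n : ℝ)| := abs_pos.2 (by exact_mod_cast hn)
  have hnC : (n : ℂ) ≠ 0 := by exact_mod_cast hn
  set q : ℝ → ℂ := fun t => ((deriv F t : ℝ) : ℂ) - m / n with hq
  have hF' : ContDiff ℝ ∞ (deriv F) := (contDiff_infty_iff_deriv.1 h.contDiff).2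
  have hqs : ContDiff ℝ ∞ q := (Complex.ofRealCLM.contDiff.comp hF').sub contDiff_const
  have hlow : ∀ t, δ ≤ ‖q t‖ := by
    intro t
    have h1 : ‖((m : ℂ) / n)‖ ≤ θ := by
      rw [norm_div, Complex.norm_intCast, Complex.norm_intCast, div_le_iff₀ hn']
      exact hmn
    have h2 := norm_sub_norm_le ((deriv F t : ℝ) : ℂ) ((m : ℂ) / n)
    rw [Complex.norm_real, Real.norm_eq_abs] at h2
    have h3 := h.expand t
    change δ ≤ ‖((deriv F t : ℝ) : ℂ) - m / n‖
    linarith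
  have hq0 : ∀ t, q t ≠ 0 := fun t ht => by
    have := hlow t
    rw [ht, norm_zero] at this
    linarith
  have hup : ∀ i, 1 ≤ i → ∀ t, ‖iteratedDeriv i q t‖ ≤ C * R ^ i * i.factorial * M i := by
    intro i hi t
    obtain ⟨i, rfl⟩ := Nat.exists_eq_add_of_le' hi
    have : deriv q = deriv fun t => ((deriv F t : ℝ) : ℂ) := by
      ext t; exact deriv_sub_const _
    rw [iteratedDeriv_succ', this, ← iteratedDeriv_succ']
    exact hbound _ t
  have hqp : Function.Periodic q 1 := fun t => by
    change ((deriv F (t + 1) : ℝ) : ℂ) - m / n = ((deriv F t : ℝ) : ℂ) - m / n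
    rw [h.periodic_deriv]
  set c : ℂ := 2 * Real.pi * Complex.I * n with hc
  have hcn : ‖c‖ = 2 * Real.pi * |(n : ℝ)| := by
    simp [hc, abs_of_pos Real.pi_pos]
  have hc0 : c ≠ 0 := norm_pos_iff.1 (by rw [hcn]; positivity)
  set E : ℝ → ℂ := fun y => Complex.exp (2 * Real.pi * Complex.I * (m * y - n * F y)) with hE
  have hEd : ∀ t, HasDerivAt E (-c * q t * E t) t := by
    intro t
    have h1 : HasDerivAt (fun y : ℝ => (m : ℂ) * (y : ℂ) - n * (F y : ℂ))
        (m * 1 - n * ((deriv F t : ℝ) : ℂ)) t :=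
      ((Complex.ofRealCLM.hasDerivAt).const_mul _).sub ((h.hasDerivAt t).ofReal_comp.const_mul _)
    refine (h1.const_mul (2 * Real.pi * Complex.I)).cexp.congr_deriv ?_
    change E t * _ = _
    simp only [hc, hq]
    field_simp
    ring
  have hE1 : E 1 = E 0 := by
    have h1 := h.add_one 0
    rw [zero_add] at h1
    simp only [hE, h1]
    rw [Complex.exp_eq_exp_iff_exists_int]
    refine ⟨m - n * d, ?_⟩
    push_cast
    ring
  have hEn : ∀ t, ‖E t‖ = 1 := by
    intro t
    have : 2 * Real.pi * Complex.I * (m * t - n * F t)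
        = ((2 * Real.pi * (m * t - n * F t) : ℝ) : ℂ) * Complex.I := by push_cast; ring
    simp only [hE]
    rw [this, Complex.norm_exp_ofReal_mul_I]
  have hf := norm_iteratedDeriv_ibpIter_le hM hmul (hqs.inv hq0) (inv_pos.2 hδ0) hρ0
    (norm_iteratedDeriv_inv_le hM hmul hqs hδ0 hC hR hlow hup) k 0
  simp only [iteratedDeriv_zero, pow_zero, mul_one, add_zero] at hf
  rw [kernel_eq, integral_eq_integral_ibpIter hqs hq0 hqp hc0 hEd hE1 k, norm_mul, norm_pow,
    norm_inv, hcn]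
  have hint := intervalIntegral.norm_integral_le_of_norm_le_const (a := (0 : ℝ)) (b := 1)
    (f := fun t => ibpIter (fun t => (q t)⁻¹) k t * E t)
    (C := (4 * δ⁻¹ * ρ) ^ k * k.factorial * M k)
    (fun y _ => by rw [norm_mul, hEn, mul_one]; exact hf y)
  rw [sub_zero, abs_one, mul_one] at hint
  calc _ ≤ ((2 * Real.pi * |(n : ℝ)|)⁻¹) ^ k * ((4 * δ⁻¹ * ρ) ^ k * k.factorial * M k) := by
        gcongr
    _ = _ := by
        rw [div_div, div_eq_mul_inv, mul_pow (4 * δ⁻¹ * ρ)]; ring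

end Kernel

section Tail

variable {T : UnitAddCircle → UnitAddCircle} {F : ℝ → ℝ} {d : ℤ} {lam : ℝ}

theorem ofReal_norm_add_sq_le (z w : ℂ) :
    ENNReal.ofReal (‖z + w‖ ^ 2)
      ≤ 2 * ENNReal.ofReal (‖z‖ ^ 2) + 2 * ENNReal.ofReal (‖w‖ ^ 2) := by
  have h2 : (2 : ℝ≥0∞) = ENNReal.ofReal 2 := by simp
  rw [h2, ← ENNReal.ofReal_mul zero_le_two, ← ENNReal.ofReal_mul zero_le_two,
    ← ENNReal.ofReal_add (by positivity) (by positivity)]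
  refine ENNReal.ofReal_le_ofReal ?_
  have h1 := norm_add_le z w
  nlinarith [norm_nonneg (z + w), norm_nonneg z, norm_nonneg w, sq_nonneg (‖z‖ - ‖w‖)]

theorem tsum_ofReal_norm_sq_fourierCoeff_transferOperator_le (hF : IsSmoothLift T F)
    (h : IsExpandingLift F d lam) {f : ℤ → ℂ} (hf : Summable fun m => ‖f m‖) :
    ∑' n, ENNReal.ofReal (‖fourierCoeff (transferOperator T (synth f)) n‖ ^ 2)
      ≤ d.natAbs * ∑' m, ENNReal.ofReal (‖f m‖ ^ 2) := by
  have hφ := continuous_synth hf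
  have h1 := tsum_norm_sq_fourierCoeff_transferOperator_le hF h hφ
  have hs2 := (hasSum_norm_sq_fourierCoeff hφ).summable
  simp_rw [fourierCoeff_synth hf] at h1 hs2
  rw [← ENNReal.ofReal_tsum_of_nonneg (fun n => by positivity)
      (hasSum_norm_sq_fourierCoeff (continuous_transferOperator hF h hφ)).summable,
    ← ENNReal.ofReal_tsum_of_nonneg (fun n => by positivity) hs2,
    ← ENNReal.ofReal_natCast, ← ENNReal.ofReal_mul (by positivity)]
  exact ENNReal.ofReal_le_ofReal h1

/-- High frequencies of the image come from high frequencies, up to the small entries of the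
matrix. -/
theorem tail_fourierCoeff_transferOperator_le (hF : IsSmoothLift T F)
    (h : IsExpandingLift F d lam) {f : ℤ → ℂ} (hf : Summable fun m => ‖f m‖) {θ : ℝ} (hθ : 0 ≤ θ)
    {κ : ℤ → ℝ} (hκ : ∀ n m : ℤ, |(m : ℝ)| ≤ θ * |(n : ℝ)| → ‖kernel F n m‖ ≤ κ n) (r : ℕ) :
    (∑' n : ℤ, if r ≤ n.natAbs then
        ENNReal.ofReal (‖fourierCoeff (transferOperator T (synth f)) n‖ ^ 2) else 0)
      ≤ 2 * d.natAbs * (∑' m : ℤ, if θ * r < |(m : ℝ)| then ENNReal.ofReal (‖f m‖ ^ 2) else 0)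
        + 2 * ∑' n : ℤ, if r ≤ n.natAbs then
            ENNReal.ofReal ((κ n * ∑' m, ‖f m‖) ^ 2) else 0 := by
  set f₁ : ℤ → ℂ := fun m => if θ * r < |(m : ℝ)| then f m else 0 with hf₁
  set f₂ : ℤ → ℂ := fun m => if θ * r < |(m : ℝ)| then 0 else f m with hf₂
  have hle₁ : ∀ m, ‖f₁ m‖ ≤ ‖f m‖ := fun m => by
    simp only [hf₁]; split_ifs <;> simp
  have hs₁ : Summable fun m => ‖f₁ m‖ := hf.of_nonneg_of_le (fun _ => norm_nonneg _) hle₁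
  have hs₂ : Summable fun m => ‖f₂ m‖ := hf.of_nonneg_of_le (fun _ => norm_nonneg _) fun m => by
    simp only [hf₂]; split_ifs <;> simp
  set c : (ℤ → ℂ) → ℤ → ℂ := fun f n => fourierCoeff (transferOperator T (synth f)) n with hc
  have hadd : ∀ n, c f n = c f₁ n + c f₂ n := by
    intro n
    have h1 := (hasSum_fourierCoeff_transferOperator_synth hF h hs₁ n).add
      (hasSum_fourierCoeff_transferOperator_synth hF h hs₂ n)
    refine (hasSum_fourierCoeff_transferOperator_synth hF h hf n).unique (h1.congr_fun ?_)
    intro m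
    simp only [hf₁, hf₂]
    split_ifs <;> simp
  have hc₂ : ∀ n : ℤ, r ≤ n.natAbs → ‖c f₂ n‖ ≤ κ n * ∑' m, ‖f m‖ := by
    intro n hn
    have hκ0 : 0 ≤ κ n := (norm_nonneg _).trans (hκ n 0 (by simp; positivity))
    have hrn : (r : ℝ) ≤ |(n : ℝ)| := by
      rw [← Int.cast_abs, ← Nat.cast_natAbs]
      exact_mod_cast hn
    simp only [hc]
    rw [← (hasSum_fourierCoeff_transferOperator_synth hF h hs₂ n).tsum_eq]
    refine tsum_of_norm_bounded (hf.hasSum.mul_left (κ n)) fun m => ?_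
    rw [norm_mul, mul_comm]
    by_cases hm : θ * r < |(m : ℝ)|
    · simp only [hf₂, if_pos hm, norm_zero, mul_zero]
      positivity
    · simp only [hf₂, if_neg hm]
      gcongr
      exact hκ n m ((not_lt.1 hm).trans (by gcongr))
  calc _ ≤ ∑' n : ℤ, (2 * ENNReal.ofReal (‖c f₁ n‖ ^ 2)
          + 2 * if r ≤ n.natAbs then ENNReal.ofReal ((κ n * ∑' m, ‖f m‖) ^ 2) else 0) := by
        refine ENNReal.tsum_le_tsum fun n => ?_
        split_ifs with hn
        · change ENNReal.ofReal (‖c f n‖ ^ 2) ≤ _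
          rw [hadd]
          refine (ofReal_norm_add_sq_le _ _).trans ?_
          gcongr
          exact hc₂ n hn
        · exact zero_le
    _ = 2 * ∑' n, ENNReal.ofReal (‖c f₁ n‖ ^ 2) + _ := by
        rw [ENNReal.tsum_add, ENNReal.tsum_mul_left, ENNReal.tsum_mul_left]
    _ ≤ _ := by
        rw [mul_assoc]
        gcongr
        refine (tsum_ofReal_norm_sq_fourierCoeff_transferOperator_le hF h hs₁).trans
          (le_of_eq ?_)
        congr 1
        refine tsum_congr fun m => ?_
        simp only [hf₁]
        split_ifs <;> simp

end Tail

section WeightedTail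

variable {M : ℕ → ℝ} {B : ℝ}

/-- The weight on `ℤ` that defines the Hilbert space. -/
noncomputable def intWeight (M : ℕ → ℝ) (B : ℝ) (n : ℤ) : ℝ := dualWeight M B |(n : ℝ)|

theorem IsWeightSeq.isRapidWeight (hM : IsWeightSeq M) (hB : 0 < B) :
    IsRapidWeight (intWeight M B) :=
  ⟨fun _ => hM.dualWeight_pos hB (abs_nonneg _), hM.summable_pow_div_dualWeight hB⟩

theorem IsWeightSeq.dualWeight_div_le (hM : IsWeightSeq M) (hB : 0 < B) {θ : ℝ} (hθ : 1 ≤ θ)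
    {r : ℝ} (hr : 1 ≤ r) {k : ℕ} (hk : 1 ≤ k) (hkr : k ≤ 3 * r) :
    dualWeight M B (r / θ) / dualWeight M B r
      ≤ θ * max 1 (B * M 1) * weightSup M (3 * B) θ k := by
  have hθ0 : 0 < θ := by linarith
  have hr0 : 0 < r := by linarith
  have h1 := hM.dualWeight_le hB (r := r / θ) (by positivity)
  have h2 := hM.inv_dualWeight_le hB hr
  have hd := hM.dualWeight_pos hB hr0.le
  have hw1 := hM.weight_pos (x := B / r) (by positivity)
  have hw2 := hM.weight_pos (x := θ * (B / r)) (by positivity)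
  have hk0 : (0 : ℝ) < k := by exact_mod_cast hk
  have h3 := hM.le_weightSup (A := 3 * B) (θ := θ) (by positivity) hθ (k := k)
    (x := 1 / (3 * r)) (by positivity) (by gcongr)
  have e1 : 3 * B * (1 / (3 * r)) = B / r := by field_simp
  have e2 : θ * (3 * B) * (1 / (3 * r)) = θ * (B / r) := by field_simp
  rw [e1, e2] at h3
  have e3 : B / (r / θ) = θ * (B / r) := by field_simp
  rw [e3] at h1
  have hC : 0 < max 1 (B * M 1) := lt_max_of_lt_left one_pos
  calc dualWeight M B (r / θ) / dualWeight M B r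
      = dualWeight M B (r / θ) * (1 / dualWeight M B r) := by rw [mul_one_div]
    _ ≤ 1 / (r / θ * weight M (θ * (B / r))) * (max 1 (B * M 1) * r * weight M (B / r)) := by
        gcongr
    _ = θ * max 1 (B * M 1) * (weight M (B / r) / weight M (θ * (B / r))) := by field_simp
    _ ≤ _ := by gcongr

theorem IsWeightSeq.dualWeight_mul_weight_le (hM : IsWeightSeq M) {A₀ : ℝ} (hA : 0 < A₀) {θ : ℝ}
    (hθ : 1 ≤ θ) {r : ℝ} (hr : 0 < r) {k : ℕ} (hk : 1 ≤ k) (hkr : k ≤ 3 * r) :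
    dualWeight M (θ * A₀) r * weight M (A₀ / r) ≤ weightSup M (3 * (θ * A₀)) θ k / r := by
  have hθ0 : 0 < θ := by linarith
  have h1 := hM.dualWeight_le (B := θ * A₀) (by positivity) hr
  have hw1 := hM.weight_pos (x := A₀ / r) (by positivity)
  have hw2 := hM.weight_pos (x := θ * A₀ / r) (by positivity)
  have hk0 : (0 : ℝ) < k := by exact_mod_cast hk
  have h3 := hM.le_weightSup (A := 3 * (θ * A₀)) (θ := θ) (by positivity) hθ (k := k)
    (x := 1 / (3 * θ * r)) (by positivity) (by
      gcongr
      nlinarith)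
  have e1 : 3 * (θ * A₀) * (1 / (3 * θ * r)) = A₀ / r := by field_simp
  have e2 : θ * (3 * (θ * A₀)) * (1 / (3 * θ * r)) = θ * A₀ / r := by field_simp
  rw [e1, e2] at h3
  calc dualWeight M (θ * A₀) r * weight M (A₀ / r)
      ≤ 1 / (r * weight M (θ * A₀ / r)) * weight M (A₀ / r) := by gcongr
    _ = weight M (A₀ / r) / weight M (θ * A₀ / r) / r := by field_simp
    _ ≤ _ := by gcongr

end WeightedTail

theorem two_mul_natCast_mul_ofReal_add (D : ℕ) {x y : ℝ} (hx : 0 ≤ x) (hy : 0 ≤ y) :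
    2 * (D : ℝ≥0∞) * ENNReal.ofReal x + 2 * ENNReal.ofReal y
      = ENNReal.ofReal (2 * D * x + 2 * y) := by
  have h2 : (2 : ℝ≥0∞) = ENNReal.ofReal 2 := by simp
  rw [h2, ← ENNReal.ofReal_natCast, ← ENNReal.ofReal_mul zero_le_two,
    ← ENNReal.ofReal_mul (by positivity), ← ENNReal.ofReal_mul zero_le_two,
    ← ENNReal.ofReal_add (by positivity) (by positivity)]

/-- A linear family of sequences with bounded `ℓ²` norm is a bounded operator. -/
theorem exists_clm_of_tsum_le {f : SeqSpace → ℤ → ℂ}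
    (hadd : ∀ u v n, f (u + v) n = f u n + f v n) (hsmul : ∀ (c : ℂ) u n, f (c • u) n = c * f u n)
    {K : ℝ} (hK : 0 ≤ K)
    (hb : ∀ u, ∑' n : ℤ, ENNReal.ofReal (‖f u n‖ ^ 2) ≤ ENNReal.ofReal ((K * ‖u‖) ^ 2)) :
    ∃ L : SeqSpace →L[ℂ] SeqSpace, ∀ u n, L u n = f u n := by
  have hmem : ∀ u, Memℓp (E := fun _ : ℤ => ℂ) (f u) 2 := by
    intro u
    have h1 := ENNReal.summable_toReal (ne_top_of_le_ne_top ENNReal.ofReal_ne_top (hb u))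
    refine memℓp_gen ?_
    simpa using h1
  let L₀ : SeqSpace →ₗ[ℂ] SeqSpace :=
    { toFun := fun u => ⟨f u, hmem u⟩
      map_add' := fun u v => Subtype.ext (funext fun n => hadd u v n)
      map_smul' := fun c u => Subtype.ext (funext fun n => hsmul c u n) }
  exact ⟨L₀.mkContinuous K fun u => SeqSpace.norm_le_of_tsum_le (by positivity) (hb u),
    fun _ _ => rfl⟩

section Main

variable {T : UnitAddCircle → UnitAddCircle} {F : ℝ → ℝ} {d : ℤ} {lam : ℝ} {M : ℕ → ℝ}

/-- The coordinates of the image of the transfer operator in the weighted space. -/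
noncomputable def imageCoord (T : UnitAddCircle → UnitAddCircle) (a : ℤ → ℝ) (h : SeqSpace)
    (n : ℤ) : ℂ :=
  a n * fourierCoeff (transferOperator T (synth (unweight a h))) n

/-- The main estimate: the tails of the transfer operator in the weighted space. -/
theorem exists_tail_imageCoord_le (hM : IsWeightSeq M) (hmul : ∀ i k, M i * M k ≤ M (i + k))
    (hF : IsSmoothLift T F) (h : IsExpandingLift F d lam)
    (hT : DenjoyCarleman M (fun x => (circleDeriv T x : ℂ))) {θ : ℝ} (hθ1 : 1 < θ)
    (hθ : θ < lam) :
    ∃ B C : ℝ, 0 < B ∧ 0 < C ∧ ∀ k : ℕ, 1 ≤ k → ∀ u : SeqSpace,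
      (∑' n : ℤ, if k / 2 ≤ n.natAbs then
        ENNReal.ofReal (‖imageCoord T (intWeight M B) u n‖ ^ 2) else 0)
      ≤ ENNReal.ofReal ((C * weightSup M (3 * B) θ k * ‖u‖) ^ 2) := by
  have hθ0 : 0 < θ := by linarith
  obtain ⟨A₀, hA₀, hker⟩ := exists_norm_kernel_le hM hmul hF h hT hθ
  set B : ℝ := θ * A₀ with hBdef
  have hB : 0 < B := by positivity
  have ha := hM.isRapidWeight hB
  set a := intWeight M B with hadef
  set κ : ℤ → ℝ := fun n => if n = 0 then 1 else weight M (A₀ / |(n : ℝ)|) with hκdef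
  have hκ : ∀ n m : ℤ, |(m : ℝ)| ≤ θ * |(n : ℝ)| → ‖kernel F n m‖ ≤ κ n := by
    intro n m hmn
    simp only [hκdef]
    split_ifs with hn
    · exact norm_kernel_le_one F n m
    · exact hker n m hn hmn
  set U : ℤ → ℝ := fun n => (if n = 0 then 1 else 0) + 1 / (n : ℝ) ^ 2 with hUdef
  have hU0 : ∀ n, 0 ≤ U n := fun n => by
    simp only [hUdef]; split_ifs <;> positivity
  have hU : Summable U :=
    ((hasSum_ite_eq (0 : ℤ) (1 : ℝ)).summable).add (Real.summable_one_div_int_pow.2 one_lt_two)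
  set P : ℝ := ∑' n : ℤ, |(n : ℝ)| ^ 0 / a n with hP
  have hP0 : 0 ≤ P := tsum_nonneg fun n => by have := ha.pos n; positivity
  have hS : ∀ u : SeqSpace, ∑' m, ‖unweight a u m‖ ≤ P * ‖u‖ := by
    intro u
    rw [mul_comm, hP, ← tsum_mul_left]
    refine (rapidDecay_unweight ha u).summable_norm.tsum_le_tsum (fun n => ?_)
      ((ha.summable 0).mul_left _)
    simpa using pow_mul_norm_unweight_le ha u 0 n
  set σ : ℕ → ℝ := weightSup M (3 * B) θ with hσ
  have hσ0 : ∀ k, 1 ≤ k → 0 < σ k := fun k hk => hM.weightSup_pos (by positivity) hθ1.le hk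
  set C₁ : ℝ := θ * max 1 (B * M 1) with hC₁
  set C₂ : ℝ := max 1 (a 0 / σ 1) with hC₂
  have hC₂1 : 1 ≤ C₂ := le_max_left _ _
  set C : ℝ := 2 * d.natAbs * C₁ ^ 2 + 2 * ((C₂ * P) ^ 2 * ∑' n, U n) + 1 with hC
  have hUs : 0 ≤ ∑' n, U n := tsum_nonneg hU0
  have hC1 : 1 ≤ C := by
    rw [hC]
    have : 0 ≤ 2 * (d.natAbs : ℝ) * C₁ ^ 2 + 2 * ((C₂ * P) ^ 2 * ∑' n, U n) := by positivity
    linarith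
  refine ⟨B, C, hB, by linarith, fun k hk u => ?_⟩
  have hσk := hσ0 k hk
  set f := unweight a u with hf
  have hfs : Summable fun m => ‖f m‖ := (rapidDecay_unweight ha u).summable_norm
  set S : ℝ := ∑' m, ‖f m‖ with hSdef
  have hS0 : 0 ≤ S := tsum_nonneg fun _ => norm_nonneg _
  have hnat : ∀ n : ℤ, ((n.natAbs : ℕ) : ℝ) = |(n : ℝ)| := fun n => by
    rw [Nat.cast_natAbs, Int.cast_abs]
  have htail := tsum_weight_mul_le
    (W := fun j => ENNReal.ofReal (dualWeight M B j ^ 2))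
    (fun i j hij => ENNReal.ofReal_le_ofReal (pow_le_pow_left₀
      (hM.dualWeight_pos hB (Nat.cast_nonneg i)).le
      (hM.dualWeight_mono hB (Nat.cast_nonneg i) (by exact_mod_cast hij)) 2)) hθ0
    (tail_fourierCoeff_transferOperator_le hF h hfs hθ0.le hκ) (k / 2)
  have hkr : ∀ n : ℤ, n ≠ 0 → k / 2 ≤ n.natAbs → (k : ℝ) ≤ 3 * |(n : ℝ)| := by
    intro n hn hkn
    rw [← hnat]
    have : k ≤ 3 * n.natAbs := by
      have := Int.natAbs_pos.2 hn
      omega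
    exact_mod_cast this
  have hfirst : (∑' m : ℤ, if θ * (k / 2 : ℕ) < |(m : ℝ)| then
      ENNReal.ofReal (dualWeight M B (⌊|(m : ℝ)| / θ⌋₊ : ℕ) ^ 2) * ENNReal.ofReal (‖f m‖ ^ 2)
      else 0) ≤ ENNReal.ofReal ((C₁ * σ k) ^ 2 * ‖u‖ ^ 2) := by
    rw [ENNReal.ofReal_mul (by positivity), SeqSpace.ofReal_norm_sq, ← ENNReal.tsum_mul_left]
    refine ENNReal.tsum_le_tsum fun m => ?_
    split_ifs with hm
    · have hm0 : m ≠ 0 := by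
        rintro rfl
        rw [Int.cast_zero, abs_zero] at hm
        exact absurd hm (not_lt.2 (by positivity))
      have hm1 : 1 ≤ |(m : ℝ)| := by
        rw [← hnat]
        exact_mod_cast Int.natAbs_pos.2 hm0
      have hkm : k / 2 ≤ m.natAbs := by
        have : ((k / 2 : ℕ) : ℝ) ≤ |(m : ℝ)| :=
          (le_mul_of_one_le_left (Nat.cast_nonneg _) hθ1.le).trans hm.le
        rw [← hnat] at this
        exact_mod_cast this
      have hd := hM.dualWeight_div_le hB hθ1.le hm1 hk (hkr m hm0 hkm)
      have ham := ha.pos m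
      rw [← ENNReal.ofReal_mul (by positivity), ← ENNReal.ofReal_mul (by positivity),
        ← mul_pow, ← mul_pow, norm_unweight ha]
      have hfl := hM.dualWeight_mono hB (Nat.cast_nonneg _)
        (Nat.floor_le (show 0 ≤ |(m : ℝ)| / θ by positivity))
      have hfl0 := (hM.dualWeight_pos hB (Nat.cast_nonneg (⌊|(m : ℝ)| / θ⌋₊))).le
      refine ENNReal.ofReal_le_ofReal (pow_le_pow_left₀ (by positivity) ?_ 2)
      calc dualWeight M B (⌊|(m : ℝ)| / θ⌋₊ : ℕ) * (‖u m‖ / a m)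
          ≤ dualWeight M B (|(m : ℝ)| / θ) * (‖u m‖ / a m) := by gcongr
        _ = dualWeight M B (|(m : ℝ)| / θ) / dualWeight M B |(m : ℝ)| * ‖u m‖ := by
            change _ * (‖u m‖ / dualWeight M B |(m : ℝ)|) = _
            ring
        _ ≤ _ := by gcongr
    · exact zero_le
  have hsecond : (∑' n : ℤ, if k / 2 ≤ n.natAbs then
      ENNReal.ofReal (dualWeight M B (n.natAbs : ℕ) ^ 2) * ENNReal.ofReal ((κ n * S) ^ 2)
      else 0) ≤ ENNReal.ofReal ((C₂ * σ k * (P * ‖u‖)) ^ 2 * ∑' n, U n) := by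
    rw [ENNReal.ofReal_mul (by positivity), ENNReal.ofReal_tsum_of_nonneg hU0 hU,
      ← ENNReal.tsum_mul_left]
    refine ENNReal.tsum_le_tsum fun n => ?_
    split_ifs with hn
    · rw [← ENNReal.ofReal_mul (by positivity), ← ENNReal.ofReal_mul (by positivity), hnat]
      refine ENNReal.ofReal_le_ofReal ?_
      have han := ha.pos n
      have hSu := hS u
      by_cases hn0 : n = 0
      · subst hn0
        have hk1 : k = 1 := by
          rw [Int.natAbs_zero] at hn; omega
        subst hk1
        have e1 : U 0 = 1 := by simp [hUdef]
        have e2 : κ 0 = 1 := by simp [hκdef]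
        rw [e1, e2, one_mul, mul_one, ← mul_pow]
        change (a 0 * S) ^ 2 ≤ _
        refine pow_le_pow_left₀ (by positivity) ?_ 2
        have : a 0 ≤ C₂ * σ 1 := by
          rw [← div_le_iff₀ hσk]; exact le_max_right _ _
        gcongr
      · have hn' : 0 < |(n : ℝ)| := abs_pos.2 (by exact_mod_cast hn0)
        have e1 : U n = (1 / |(n : ℝ)|) ^ 2 := by
          simp [hUdef, hn0]
        have e2 : κ n = weight M (A₀ / |(n : ℝ)|) := by simp [hκdef, hn0]
        have hd := hM.dualWeight_mul_weight_le hA₀ hθ1.le hn' hk (hkr n hn0 hn)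
        have hw := hM.weight_pos (x := A₀ / |(n : ℝ)|) (by positivity)
        have hdw := hM.dualWeight_pos hB hn'.le
        rw [e1, e2, ← mul_pow, ← mul_pow]
        refine pow_le_pow_left₀ (by positivity) ?_ 2
        calc dualWeight M B |(n : ℝ)| * (weight M (A₀ / |(n : ℝ)|) * S)
            = dualWeight M B |(n : ℝ)| * weight M (A₀ / |(n : ℝ)|) * S := by ring
          _ ≤ σ k / |(n : ℝ)| * (P * ‖u‖) := by gcongr
          _ = 1 * (σ k * (P * ‖u‖) * (1 / |(n : ℝ)|)) := by ring
          _ ≤ C₂ * (σ k * (P * ‖u‖) * (1 / |(n : ℝ)|)) := by gcongr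
          _ = _ := by ring
    · exact zero_le
  have hlhs : (∑' n : ℤ, if k / 2 ≤ n.natAbs then
        ENNReal.ofReal (‖imageCoord T a u n‖ ^ 2) else 0)
      = ∑' n : ℤ, if k / 2 ≤ n.natAbs then ENNReal.ofReal (dualWeight M B (n.natAbs : ℕ) ^ 2)
        * ENNReal.ofReal (‖fourierCoeff (transferOperator T (synth f)) n‖ ^ 2) else 0 := by
    refine tsum_congr fun n => if_congr Iff.rfl ?_ rfl
    rw [imageCoord, norm_mul, Complex.norm_of_nonneg (ha.pos n).le, mul_pow,
      ENNReal.ofReal_mul (by positivity), hnat]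
    rfl
  rw [hlhs]
  refine htail.trans ((add_le_add (mul_le_mul_right hfirst _)
    (mul_le_mul_right hsecond _)).trans ?_)
  rw [two_mul_natCast_mul_ofReal_add _ (by positivity) (by positivity)]
  refine ENNReal.ofReal_le_ofReal ?_
  calc 2 * (d.natAbs : ℝ) * ((C₁ * σ k) ^ 2 * ‖u‖ ^ 2)
        + 2 * ((C₂ * σ k * (P * ‖u‖)) ^ 2 * ∑' n, U n)
      = (C - 1) * (σ k * ‖u‖) ^ 2 := by rw [hC]; ring
    _ ≤ C ^ 2 * (σ k * ‖u‖) ^ 2 := by gcongr; nlinarith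
    _ = _ := by ring

theorem imageCoord_add (hF : IsSmoothLift T F) (h : IsExpandingLift F d lam) {a : ℤ → ℝ}
    (ha : IsRapidWeight a) (u v : SeqSpace) (n : ℤ) :
    imageCoord T a (u + v) n = imageCoord T a u n + imageCoord T a v n := by
  have hs := fun w => hasSum_fourierCoeff_transferOperator_synth hF h
    (rapidDecay_unweight ha w).summable_norm n
  rw [imageCoord, imageCoord, imageCoord, ← mul_add]
  congr 1
  refine (hs (u + v)).unique (((hs u).add (hs v)).congr_fun fun m => ?_)
  simp only [unweight, lp.coeFn_add, Pi.add_apply]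
  ring

theorem imageCoord_smul (hF : IsSmoothLift T F) (h : IsExpandingLift F d lam) {a : ℤ → ℝ}
    (ha : IsRapidWeight a) (c : ℂ) (u : SeqSpace) (n : ℤ) :
    imageCoord T a (c • u) n = c * imageCoord T a u n := by
  have hs := fun w => hasSum_fourierCoeff_transferOperator_synth hF h
    (rapidDecay_unweight ha w).summable_norm n
  rw [imageCoord, imageCoord, mul_left_comm]
  congr 1
  refine (hs (c • u)).unique (((hs u).mul_left c).congr_fun fun m => ?_)
  simp only [unweight, lp.coeFn_smul, Pi.smul_apply, smul_eq_mul]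
  ring

theorem embed_eq_transferOperator (hF : IsSmoothLift T F) (h : IsExpandingLift F d lam)
    {a : ℤ → ℝ} (ha : IsRapidWeight a) {u v : SeqSpace} (huv : ∀ n, v n = imageCoord T a u n) :
    (embed ha v : UnitAddCircle → ℂ) = transferOperator T (embed ha u) := by
  have hc := continuous_transferOperator hF h
    (continuous_synth (rapidDecay_unweight ha u).summable_norm)
  have hcoeff : ∀ n, fourierCoeff (transferOperator T (synth (unweight a u))) n
      = unweight a v n := by
    intro n
    have : (a n : ℂ) ≠ 0 := by exact_mod_cast (ha.pos n).ne'
    rw [unweight, huv, imageCoord, mul_div_cancel_left₀ _ this]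
  ext x
  rw [coe_embed, coe_embed]
  have hsum : Summable (fourierCoeff (⟨_, hc⟩ : C(UnitAddCircle, ℂ))) :=
    (rapidDecay_unweight ha v).summable_norm.of_norm.congr fun n => (hcoeff n).symm
  have h1 := has_pointwise_sum_fourier_series_of_summable hsum x
  rw [synth]
  refine HasSum.tsum_eq (h1.congr_fun fun n => ?_)
  change _ = fourierCoeff (transferOperator T (synth (unweight a u))) n • _
  rw [hcoeff, smul_eq_mul]

end Main

end CircleDC

open CircleDC in
theorem mainTheorem2
    (M : ℕ → ℝ) (hM_pos : ∀ k, 0 < M k) (hM_zero : M 0 = 1) (hM_mono : Monotone M)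
    (hM_logconvex : ∀ k, 1 ≤ k → M k ^ 2 ≤ M (k - 1) * M (k + 1))
    (T : UnitAddCircle → UnitAddCircle) (hT : CircleDC.IsSmoothCircleMap T)
    (lam : ℝ) (hlam : 1 < lam) (hT_exp : ∀ x, lam ≤ |CircleDC.circleDeriv T x|)
    (hT_class : CircleDC.DenjoyCarleman M (fun x => (CircleDC.circleDeriv T x : ℂ)))
    (θ : ℝ) (hθ : θ ∈ Set.Ioo 1 lam) :
    ∃ C A : ℝ, 0 < C ∧ 0 < A ∧
      ∃ (H : Type) (_ : NormedAddCommGroup H) (_ : InnerProductSpace ℂ H) (_ : CompleteSpace H)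
        (ι : H →L[ℂ] CircleDC.SmoothFun),
        Function.Injective ι ∧
        (∀ p ∈ CircleDC.trigPolynomials, ∃ h : H, (ι h : UnitAddCircle → ℂ) = p) ∧
        Dense {h : H | (ι h : UnitAddCircle → ℂ) ∈ CircleDC.trigPolynomials} ∧
        ∃ L : H →L[ℂ] H,
          (∀ h : H, (ι (L h) : UnitAddCircle → ℂ) = CircleDC.transferOperator T (ι h)) ∧
          IsCompactOperator L ∧
          ∀ k : ℕ, 1 ≤ k →
            CircleDC.singularValue L k ≤
              C * ⨆ x : Set.Ioc (0 : ℝ) (1 / (k : ℝ)),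
                CircleDC.weight M (A * x) / CircleDC.weight M (θ * A * x) := by
  obtain ⟨F, hF⟩ := hT
  obtain ⟨d, hd⟩ := exists_degree hF
  have hM : IsWeightSeq M := ⟨hM_zero, hM_mono⟩
  have h : IsExpandingLift F d lam := ⟨hF.1, hd, hlam, fun t => by
    rw [← circleDeriv_coe hF]; exact hT_exp _⟩
  obtain ⟨B, C, hB, hC, htail⟩ := exists_tail_imageCoord_le hM
    (mul_le_of_logConvex hM_pos hM_zero hM_logconvex) hF h hT_class hθ.1 hθ.2
  have hA : 0 < 3 * B := by positivity
  have ha := hM.isRapidWeight hB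
  have hσ : ∀ k, 1 ≤ k → 0 ≤ C * weightSup M (3 * B) θ k := fun k hk =>
    (mul_pos hC (hM.weightSup_pos hA hθ.1.le hk)).le
  obtain ⟨L, hL⟩ := exists_clm_of_tsum_le (imageCoord_add hF h ha) (imageCoord_smul hF h ha)
    (hσ 1 le_rfl) fun u => by simpa using htail 1 le_rfl u
  have htrunc : ∀ k, 1 ≤ k → ∀ u, ‖L u - SeqSpace.trunc (k / 2) (L u)‖
      ≤ C * weightSup M (3 * B) θ k * ‖u‖ := by
    intro k hk u
    refine SeqSpace.norm_sub_trunc_le (mul_nonneg (hσ k hk) (norm_nonneg u)) ?_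
    simp_rw [hL]
    exact htail k hk u
  refine ⟨C, 3 * B, hC, hA, SeqSpace, inferInstance, inferInstance, inferInstance, embed ha,
    injective_embed ha, fun p hp => exists_embed_eq ha hp, dense_embed_trigPolynomials ha, L,
    fun u => embed_eq_transferOperator hF h ha (hL u), ?_, fun k hk => ?_⟩
  · refine SeqSpace.isCompactOperator_of_tail
      (s := fun N => C * weightSup M (3 * B) θ (2 * N + 1)) (fun N => hσ _ (by omega)) ?_
      fun N u => ?_
    · have h1 := (hM.tendsto_weightSup hA hθ.1).comp
        (Filter.tendsto_atTop_mono (fun N : ℕ => (by omega : N ≤ 2 * N + 1)) Filter.tendsto_id)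
      simpa using h1.const_mul C
    · have h1 := htrunc (2 * N + 1) (by omega) u
      rwa [show (2 * N + 1) / 2 = N by omega] at h1
  · exact SeqSpace.singularValue_le_of_tail (hσ k hk) hk (by omega) (htrunc k hk)
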